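/- Let $\Gamma$ be a discrete subgroup of $\mathrm{SL}_2(\mathbb R)$ (for instance the preimage of a discrete subgroup of $\mathrm{PSL}_2(\mathbb R)$) acting on the upper half plane $\mathbf H$, $z=x+iy$, such that $\Gamma\backslash\mathbf H$ is non-compact and has finite volume for $d\mu=dx\,dy/y^2$. Let $\{\mathfrak a\}$ be a complete set of representatives of the $\Gamma$-inequivalent cusps, where a cusp is a point of $\mathbb R\cup\{\infty\}$ fixed by a parabolic element of $\Gamma$. For each $\mathfrak a$ let $\sigma_{\mathfrak a}\in \mathrm{SL}_2(\mathbb R)$ be a scaling matrix: $\sigma_{\mathfrak a}\infty=\mathfrak a$ and, modulo $\pm1$, $\sigma_{\mathfrak a}^{-1}\Gamma_{\mathfrak a}\sigma_{\mathfrak a}=\{\left(\begin{smallmatrix}1&m\\0&1\end{smallmatrix}\right): m\in\mathbb Z\}$, where $\Gamma_{\mathfrak a}$ is the stabilizer of $\mathfrak a$ in $\Gamma$. Put $$y_\Gamma(z)=\max_{\mathfrak a}\max_{\gamma\in\Gamma}\operatorname{Im}(\sigma_{\mathfrak a}^{-1}\gamma z).$$ For $k\in\mathbb Z$ let $C^\infty(\Gamma\backslash\mathbf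 H,k)$ be the space of smooth functions $\psi:\mathbf H\to\mathbb C$ with $\psi(\gamma z)=\varepsilon(\gamma,z)^k\psi(z)$ for all $\gamma\in\Gamma$, where $\varepsilon(\gamma,z)=j(\gamma,z)/|j(\gamma,z)|$ and $j(\left(\begin{smallmatrix}a&b\\c&d\end{smallmatrix}\right),z)=cz+d$. Let $$R_k=2iy\frac{d}{dz}+\frac k2,\qquad L_k=-2iy\frac{d}{d\bar z}-\frac k2$$ be the Maass raising and lowering operators, where $\frac{d}{dz}=\frac12\left(\frac{\partial}{\partial x}-i\frac{\partial}{\partial y}\right)$ and $\frac{d}{d\bar z}=\frac12\left(\frac{\partial}{\partial x}+i\frac{\partial}{\partial y}\right)$, and let $\langle\psi_1,\psi_2\rangle=\int_{\Gamma\backslash\mathbf H}\psi_1(z)\overline{\psi_2(z)}\,d\mu(z)$. Suppose $\phi_1\in C^\infty(\Gamma\backslash\mathbf H,k)$ and $\phi_2\in C^\infty(\Gamma\backslash\mathbf H,k+2)$, and let $A,B\in\mathbb R$ with $A+B<0$. If, on $\mathbf H$, $$\phi_1(z),\ R_k\phi_1(z)\ll y_\Gamma(z)^A\qquad\text{and}\qquad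 \phi_2(z),\ L_{k+2}\phi_2(z)\ll y_\Gamma(z)^B,$$ then the integrals defining the two inner products below converge absolutely and $$\langle R_k\phi_1,\phi_2\rangle+\langle\phi_1,L_{k+2}\phi_2\rangle=0.$$ -/

import Mathlib

open scoped MatrixGroups UpperHalfPlane ContDiff

noncomputable section

namespace MaassForms

open MeasureTheory UpperHalfPlane Matrix.SpecialLinearGroup

/-- The automorphy factor `j(γ, z) = c z + d`. -/
def autJ (γ : SL(2, ℝ)) (z : ℍ) : ℂ := (γ 1 0 : ℂ) * (z : ℂ) + (γ 1 1 : ℂ)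

/-- `ε(γ, z) = j(γ, z) / |j(γ, z)|`. -/
def autEps (γ : SL(2, ℝ)) (z : ℍ) : ℂ := autJ γ z / (‖autJ γ z‖ : ℂ)

/-- Membership in `C^∞(Γ \ ℍ, k)`: smooth functions on `ℍ` (in the real sense) with
`ψ(γ z) = ε(γ, z)^k ψ(z)` for all `γ ∈ Γ`. -/
structure IsSmoothForm (Γ : Subgroup SL(2, ℝ)) (k : ℤ) (ψ : ℍ → ℂ) : Prop where
  smooth : ContDiffOn ℝ ∞ (ψ ∘ UpperHalfPlane.ofComplex) {w : ℂ | 0 < w.im}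
  transform : ∀ γ ∈ Γ, ∀ z : ℍ, ψ (γ • z) = autEps γ z ^ k * ψ z

/-- The partial derivative `∂/∂x` of a function on `ℍ`, where `z = x + i y`. -/
def dx (ψ : ℍ → ℂ) (z : ℍ) : ℂ := fderiv ℝ (ψ ∘ UpperHalfPlane.ofComplex) (z : ℂ) 1

/-- The partial derivative `∂/∂y` of a function on `ℍ`, where `z = x + i y`. -/
def dy (ψ : ℍ → ℂ) (z : ℍ) : ℂ := fderiv ℝ (ψ ∘ UpperHalfPlane.ofComplex) (z : ℂ) Complex.I

/-- `d/dz = (1/2) (∂/∂x - i ∂/∂y)`. -/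
def ddz (ψ : ℍ → ℂ) (z : ℍ) : ℂ := (dx ψ z - Complex.I * dy ψ z) / 2

/-- `d/dz̄ = (1/2) (∂/∂x + i ∂/∂y)`. -/
def ddzbar (ψ : ℍ → ℂ) (z : ℍ) : ℂ := (dx ψ z + Complex.I * dy ψ z) / 2

/-- The Maass raising operator `R_k = 2 i y d/dz + k/2`. -/
def raising (k : ℤ) (ψ : ℍ → ℂ) (z : ℍ) : ℂ :=
  2 * Complex.I * (z.im : ℂ) * ddz ψ z + (k : ℂ) / 2 * ψ z

/-- The Maass lowering operator `L_k = -2 i y d/dz̄ - k/2`. -/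
def lowering (k : ℤ) (ψ : ℍ → ℂ) (z : ℍ) : ℂ :=
  -2 * Complex.I * (z.im : ℂ) * ddzbar ψ z - (k : ℂ) / 2 * ψ z

/-- A complete system of representatives for the `Γ`-inequivalent cusps of `Γ`, each with a scaling
matrix. Cusps are the fixed points in `ℝ ∪ {∞}` of the parabolic elements of `Γ`. -/
structure CuspSystem (Γ : Subgroup SL(2, ℝ)) (ι : Type*) where
  /-- the representatives of the cusps -/
  cusp : ι → OnePoint ℝ
  /-- the scaling matrices -/
  σ : ι → SL(2, ℝ)
  isCusp : ∀ a, IsCusp (cusp a) (Γ.map (mapGL ℝ))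
  /-- every cusp is `Γ`-equivalent to exactly one representative -/
  complete : ∀ c : OnePoint ℝ, IsCusp c (Γ.map (mapGL ℝ)) →
    ∃! a, ∃ γ ∈ Γ, mapGL ℝ γ • cusp a = c
  σ_infty : ∀ a, mapGL ℝ (σ a) • (OnePoint.infty : OnePoint ℝ) = cusp a
  /-- modulo `± 1`, conjugation by the scaling matrix takes the stabilizer of the cusp in `Γ` to the
  group of integral translations -/
  scaling : ∀ a, ∀ g : SL(2, ℝ),
    ((g ∈ Γ ∨ -g ∈ Γ) ∧ mapGL ℝ g • cusp a = cusp a) ↔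
      ∃ m : ℤ, ((σ a)⁻¹ * g * σ a).1 = !![1, (m : ℝ); 0, 1] ∨
        ((σ a)⁻¹ * g * σ a).1 = -!![1, (m : ℝ); 0, 1]

/-- The height function `y_Γ(z) = max_a max_{γ ∈ Γ} Im(σ_a⁻¹ γ z)`. -/
def CuspSystem.height {Γ : Subgroup SL(2, ℝ)} {ι : Type*} (S : CuspSystem Γ ι) (z : ℍ) : ℝ :=
  ⨆ p : ι × Γ, (((S.σ p.1)⁻¹ * (p.2 : SL(2, ℝ))) • z).im

/-- `ψ(z) ≪ y_Γ(z)^A` on `ℍ`. -/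
def CuspSystem.HasGrowth {Γ : Subgroup SL(2, ℝ)} {ι : Type*} (S : CuspSystem Γ ι)
    (ψ : ℍ → ℂ) (A : ℝ) : Prop :=
  ∃ C : ℝ, ∀ z : ℍ, ‖ψ z‖ ≤ C * S.height z ^ A

/-- `D` is a fundamental domain (up to null sets) for `Γ` acting on `ℍ` by Möbius transformations.
As `-1` acts trivially, the group that is used is the group of transformations of `ℍ` induced
by `Γ`, i.e. the image of `Γ` in `PSL(2, ℝ)`. -/
def IsFundDomain (Γ : Subgroup SL(2, ℝ)) (D : Set ℍ) : Prop :=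
  IsFundamentalDomain (Γ.map (MulAction.toPermHom SL(2, ℝ) ℍ)) D volume

/-- The integrand `φ₁(z) \overline{φ₂(z)}` of the inner product. -/
def pairing (φ₁ φ₂ : ℍ → ℂ) (z : ℍ) : ℂ := φ₁ z * (starRingEnd ℂ) (φ₂ z)

/-- The inner product `⟨φ₁, φ₂⟩ = ∫_{Γ \ ℍ} φ₁ \overline{φ₂} dμ`, computed over a fundamental
domain `D`; the volume on `ℍ` is `dμ = dx dy / y²`. -/
def petersson (D : Set ℍ) (φ₁ φ₂ : ℍ → ℂ) : ℂ := ∫ z in D, pairing φ₁ φ₂ z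

end MaassForms

end

/-!
The product rule shows that the sum of the two integrands is `R f`, with `R` the raising operator of
weight `-2` and `f = φ₁ \overline{φ₂}`, a form of weight `-2`
(`MaassForms.pairing_raising_add_pairing_lowering`, `MaassForms.isSmoothForm_pairing`). As
`R f = 2 i y² ∂(f / y)/∂z`, the sum of the integrals is that of an exact form, and the claim is
Stokes' theorem on a quotient of finite volume for `f` such that `f` and `R f` are bounded.

**Boundedness.** As `A + B < 0`, `f` and both integrands are bounded once the height `y_Γ` has a positive
lower bound, `MaassForms.CuspSystem.exists_le_height`. This is proved by a thick-thin decomposition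
(`MaassForms.exists_entries_le_or_le_im`), without choosing a fundamental polygon. Points of `ℍ` are
replaced by frames `τ ∈ SL(2, ℝ)`, with `z = τ • i`, and a frame is thick if no nontrivial element
of `Γ` is close to the identity in it. Elements close to the identity in a common frame commute
(`MaassForms.commute_of_disp_lt`, Zassenhaus). Finite volume bounds the thick frames modulo `Γ`, by
a packing argument (`MaassForms.exists_entries_le_of_thick`). From a thin frame one reaches a thick
one along a unipotent path, keeping a short element that commutes with the given short element `γ`
(`MaassForms.exists_thick_of_thin`); thus up to conjugation `γ` commutes with one of finitely many
elements `β`. If `β` is elliptic or hyperbolic, the thin frames around it are bounded modulo its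
powers. If `β` is parabolic, so is `γ`, and the point is high above a cusp. Hence a point is either
in the orbit of a fixed compact set, or high above a cusp; on the compact set the height is bounded
below because there is at least one cusp, the quotient being non-compact.

**Stokes.** `MaassForms.setIntegral_raising_eq_zero` needs neither the shape of a fundamental domain
nor cutoffs in the cusps. Let `u(z, w)` be a bump depending only on the distance of `z` and `w`. The
integral `∫ u(z, w) (R f)(w) dμ(w)` is integrated over `z ∈ D`; the kernel is invariant under the
diagonal action of `Γ`, so that the roles of the variables can be exchanged, and the result is
`∫_D R f` times the positive constant `∫ u(z, w) dμ(z)`. Integrating by parts in `w` first, one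
gets `-∫_D f(w) ∫ K(z, w) dμ(z) dμ(w)` with `K = 2 i Im(w) ∂u/∂w`. The inner integral vanishes,
since the half turn about `w` changes the sign of `K` (`MaassForms.integral_bumpDeriv`).
-/

noncomputable section

namespace MaassForms

open MeasureTheory UpperHalfPlane Matrix.SpecialLinearGroup

section Frames

open scoped Matrix.Norms.Frobenius

/-! ### Short elements of a discrete group -/

lemma isCompact_entries_le (R : ℝ) : IsCompact {g : SL(2, ℝ) | ∀ i j, |g.1 i j| ≤ R} := by
  have hc : IsCompact {m : Matrix (Fin 2) (Fin 2) ℝ | ∀ i j, |m i j| ≤ R} := by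
    have : {m : Matrix (Fin 2) (Fin 2) ℝ | ∀ i j, |m i j| ≤ R} =
        Set.univ.pi fun _ => Set.univ.pi fun _ => Set.Icc (-R) R := by
      ext m
      exact ⟨fun h i _ j _ => abs_le.mp (h i j), fun h i j => abs_le.mpr (h i trivial j trivial)⟩
    rw [this]
    exact isCompact_univ_pi fun _ => isCompact_univ_pi fun _ => isCompact_Icc
  exact Matrix.SpecialLinearGroup.isClosedEmbedding_val.isCompact_preimage hc

lemma finite_of_entries_le (Γ : Subgroup SL(2, ℝ)) [DiscreteTopology Γ] (R : ℝ) :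
    {γ : SL(2, ℝ) | γ ∈ Γ ∧ ∀ i j, |γ.1 i j| ≤ R}.Finite := by
  have hcl : IsClosed (Γ : Set SL(2, ℝ)) := Subgroup.isClosed_of_discrete
  have hd : IsDiscrete (Γ : Set SL(2, ℝ)) := ⟨‹_›⟩
  exact ((isCompact_entries_le R).inter_left hcl).finite (hd.mono Set.inter_subset_left)


lemma frobenius_sq (M : Matrix (Fin 2) (Fin 2) ℝ) :
    ‖M‖ ^ 2 = M 0 0 ^ 2 + M 0 1 ^ 2 + M 1 0 ^ 2 + M 1 1 ^ 2 := by
  rw [Matrix.frobenius_norm_def, ← Real.rpow_natCast, ← Real.rpow_mul (by positivity)]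
  simp [Fin.sum_univ_two]
  ring

lemma abs_entry_le_norm (M : Matrix (Fin 2) (Fin 2) ℝ) (i j : Fin 2) : |M i j| ≤ ‖M‖ := by
  refine abs_le_of_sq_le_sq ?_ (norm_nonneg M)
  rw [frobenius_sq]
  fin_cases i <;> fin_cases j <;> simp <;>
    nlinarith [sq_nonneg (M 0 0), sq_nonneg (M 0 1), sq_nonneg (M 1 0), sq_nonneg (M 1 1)]

lemma norm_le_of_entries {M : Matrix (Fin 2) (Fin 2) ℝ} {R : ℝ} (h : ∀ i j, |M i j| ≤ R) :
    ‖M‖ ≤ 2 * R := by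
  have hR : 0 ≤ R := (abs_nonneg _).trans (h 0 0)
  apply abs_le_of_sq_le_sq' _ (by positivity) |>.2
  rw [frobenius_sq]
  have := fun i j => sq_le_sq' (abs_le.mp (h i j)).1 (abs_le.mp (h i j)).2
  nlinarith [this 0 0, this 0 1, this 1 0, this 1 1]

lemma det_entries (g : SL(2, ℝ)) : g.1 0 0 * g.1 1 1 - g.1 0 1 * g.1 1 0 = 1 := by
  have := g.2; rwa [Matrix.det_fin_two] at this

lemma coe_inv_entries (g : SL(2, ℝ)) :
    ((g⁻¹ : SL(2, ℝ)) : Matrix (Fin 2) (Fin 2) ℝ) = !![g.1 1 1, -g.1 0 1; -g.1 1 0, g.1 0 0] := by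
  rw [SL2_inv_expl]; rfl

lemma norm_coe_inv (g : SL(2, ℝ)) :
    ‖((g⁻¹ : SL(2, ℝ)) : Matrix (Fin 2) (Fin 2) ℝ)‖ = ‖(g : Matrix (Fin 2) (Fin 2) ℝ)‖ := by
  rw [← sq_eq_sq₀ (norm_nonneg _) (norm_nonneg _), frobenius_sq, frobenius_sq, coe_inv_entries]
  simp; ring

lemma norm_one_sq : ‖(1 : Matrix (Fin 2) (Fin 2) ℝ)‖ ^ 2 = 2 := by
  rw [frobenius_sq]; norm_num

lemma norm_one_le : ‖(1 : Matrix (Fin 2) (Fin 2) ℝ)‖ ≤ 3 / 2 := by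
  nlinarith [norm_one_sq, norm_nonneg (1 : Matrix (Fin 2) (Fin 2) ℝ)]

/-- The size of `γ` seen from the frame `τ`: the Frobenius distance of `τ⁻¹ γ τ` to the identity.
It is small when `γ` moves the point `τ • i` by little and rotates little there. -/
def disp (τ γ : SL(2, ℝ)) : ℝ := ‖((τ⁻¹ * γ * τ : SL(2, ℝ)) : Matrix (Fin 2) (Fin 2) ℝ) - 1‖

lemma disp_pos {τ γ : SL(2, ℝ)} (h : γ ≠ 1) : 0 < disp τ γ := by
  rw [disp, norm_pos_iff, sub_ne_zero]
  intro h1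
  apply h
  have : τ⁻¹ * γ * τ = 1 := Subtype.ext h1
  calc γ = τ * (τ⁻¹ * γ * τ) * τ⁻¹ := by group
    _ = 1 := by rw [this]; group

lemma ne_neg_one_of_disp_lt {τ γ : SL(2, ℝ)} (h : disp τ γ < 1 / 10) : γ ≠ -1 := by
  rintro rfl
  have h1 : τ⁻¹ * (-1) * τ = -1 := by simp
  rw [disp, h1] at h
  have h2 := abs_entry_le_norm (((-1 : SL(2, ℝ)) : Matrix (Fin 2) (Fin 2) ℝ) - 1) 0 0
  simp only [coe_neg, coe_one, Matrix.sub_apply, Matrix.neg_apply, Matrix.one_apply_eq] at h2 h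
  norm_num at h2 h
  linarith

lemma disp_mul_left (δ τ γ : SL(2, ℝ)) : disp (δ * τ) (δ * γ * δ⁻¹) = disp τ γ := by
  have h : (δ * τ)⁻¹ * (δ * γ * δ⁻¹) * (δ * τ) = τ⁻¹ * γ * τ := by group
  rw [disp, disp, h]

/-- Changing the frame by `s` on the right changes the displacement by at most `‖s‖²`. -/
lemma disp_mul_right_le (τ s γ : SL(2, ℝ)) :
    disp (τ * s) γ ≤ ‖(s : Matrix (Fin 2) (Fin 2) ℝ)‖ ^ 2 * disp τ γ := by
  have h : (((τ * s)⁻¹ * γ * (τ * s) : SL(2, ℝ)) : Matrix (Fin 2) (Fin 2) ℝ) - 1 =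
      ((s⁻¹ : SL(2, ℝ)) : Matrix (Fin 2) (Fin 2) ℝ) *
        (((τ⁻¹ * γ * τ : SL(2, ℝ)) : Matrix (Fin 2) (Fin 2) ℝ) - 1) * s := by
    have h' : (τ * s)⁻¹ * γ * (τ * s) = s⁻¹ * (τ⁻¹ * γ * τ) * s := by group
    rw [mul_sub, sub_mul, mul_one, ← coe_mul, ← coe_mul, ← coe_mul, inv_mul_cancel, coe_one, h']
  unfold disp
  rw [h]
  refine (norm_mul_le _ _).trans ?_
  calc _ ≤ ‖((s⁻¹ : SL(2, ℝ)) : Matrix (Fin 2) (Fin 2) ℝ)‖ * _ * _ := by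
        gcongr; exact norm_mul_le _ _
    _ = _ := by rw [norm_coe_inv]; ring

/-- Elements of bounded displacement in a fixed frame have bounded entries. -/
lemma entries_le_of_disp_le {τ γ : SL(2, ℝ)} {R : ℝ} (h : disp τ γ ≤ R) (i j : Fin 2) :
    |γ.1 i j| ≤ ‖(τ : Matrix (Fin 2) (Fin 2) ℝ)‖ ^ 2 * (R + 3 / 2) := by
  refine (abs_entry_le_norm _ i j).trans ?_
  have h1 : (γ : Matrix (Fin 2) (Fin 2) ℝ) = τ * ((τ⁻¹ * γ * τ : SL(2, ℝ)) :
      Matrix (Fin 2) (Fin 2) ℝ) * ((τ⁻¹ : SL(2, ℝ)) : Matrix (Fin 2) (Fin 2) ℝ) := by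
    rw [← coe_mul, ← coe_mul, show τ * (τ⁻¹ * γ * τ) * τ⁻¹ = γ by group]
  have h2 : ‖((τ⁻¹ * γ * τ : SL(2, ℝ)) : Matrix (Fin 2) (Fin 2) ℝ)‖ ≤ R + 3 / 2 := by
    have := norm_add_le (((τ⁻¹ * γ * τ : SL(2, ℝ)) : Matrix (Fin 2) (Fin 2) ℝ) - 1) 1
    rw [sub_add_cancel] at this
    have := norm_one_le
    unfold disp at h
    linarith
  calc ‖(γ : Matrix (Fin 2) (Fin 2) ℝ)‖ ≤
        ‖(τ : Matrix (Fin 2) (Fin 2) ℝ)‖ * ‖((τ⁻¹ * γ * τ : SL(2, ℝ)) : Matrix (Fin 2) (Fin 2) ℝ)‖ *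
          ‖((τ⁻¹ : SL(2, ℝ)) : Matrix (Fin 2) (Fin 2) ℝ)‖ := by
        conv_lhs => rw [h1]
        refine (norm_mul_le _ _).trans ?_
        gcongr; exact norm_mul_le _ _
    _ ≤ ‖(τ : Matrix (Fin 2) (Fin 2) ℝ)‖ * (R + 3 / 2) * ‖(τ : Matrix (Fin 2) (Fin 2) ℝ)‖ := by
        rw [norm_coe_inv]; gcongr
    _ = _ := by ring

/-- Writing `xy - yx = (x - 1)(y - 1) - (y - 1)(x - 1)` shows that commutators contract towards
the identity. -/
lemma norm_commutator_sub_one_le (x y : SL(2, ℝ)) :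
    ‖((x * y * x⁻¹ * y⁻¹ : SL(2, ℝ)) : Matrix (Fin 2) (Fin 2) ℝ) - 1‖ ≤
      2 * ‖(x : Matrix (Fin 2) (Fin 2) ℝ) - 1‖ * ‖(y : Matrix (Fin 2) (Fin 2) ℝ) - 1‖ *
        (‖(x : Matrix (Fin 2) (Fin 2) ℝ)‖ * ‖(y : Matrix (Fin 2) (Fin 2) ℝ)‖) := by
  set X := (x : Matrix (Fin 2) (Fin 2) ℝ)
  set Y := (y : Matrix (Fin 2) (Fin 2) ℝ)
  have h : ((x * y * x⁻¹ * y⁻¹ : SL(2, ℝ)) : Matrix (Fin 2) (Fin 2) ℝ) - 1 =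
      ((X - 1) * (Y - 1) - (Y - 1) * (X - 1)) *
        (((x⁻¹ : SL(2, ℝ)) : Matrix (Fin 2) (Fin 2) ℝ) *
          ((y⁻¹ : SL(2, ℝ)) : Matrix (Fin 2) (Fin 2) ℝ)) := by
    have h1 : (X - 1) * (Y - 1) - (Y - 1) * (X - 1) = X * Y - Y * X := by noncomm_ring
    have h2 : Y * X * (((x⁻¹ : SL(2, ℝ)) : Matrix (Fin 2) (Fin 2) ℝ) *
        ((y⁻¹ : SL(2, ℝ)) : Matrix (Fin 2) (Fin 2) ℝ)) = 1 := by
      rw [← coe_mul, ← coe_mul, ← coe_mul, show y * x * (x⁻¹ * y⁻¹) = 1 by group, coe_one]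
    rw [h1, sub_mul, h2]
    simp only [coe_mul, mul_assoc, X, Y]
  rw [h]
  calc _ ≤ ‖(X - 1) * (Y - 1) - (Y - 1) * (X - 1)‖ *
        (‖((x⁻¹ : SL(2, ℝ)) : Matrix (Fin 2) (Fin 2) ℝ)‖ *
          ‖((y⁻¹ : SL(2, ℝ)) : Matrix (Fin 2) (Fin 2) ℝ)‖) := by
        refine (norm_mul_le _ _).trans ?_
        gcongr; exact norm_mul_le _ _
    _ ≤ (‖X - 1‖ * ‖Y - 1‖ + ‖Y - 1‖ * ‖X - 1‖) * (‖X‖ * ‖Y‖) := by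
        rw [norm_coe_inv, norm_coe_inv]
        gcongr
        refine (norm_sub_le _ _).trans ?_
        gcongr <;> exact norm_mul_le _ _
    _ = _ := by ring

lemma eq_one_or_neg_one_of_entries {g : SL(2, ℝ)} (h1 : g.1 0 1 = 0) (h2 : g.1 1 0 = 0)
    (h3 : g.1 0 0 = g.1 1 1) : g = 1 ∨ g = -1 := by
  have hd := det_entries g
  rw [h1, h3] at hd
  have h : (g.1 1 1 - 1) * (g.1 1 1 + 1) = 0 := by linarith
  rcases mul_eq_zero.mp h with h | h
  · left; ext i j; fin_cases i <;> fin_cases j <;> simp [h1, h2, h3] <;> linarith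
  · right; ext i j; fin_cases i <;> fin_cases j <;> simp [h1, h2, h3] <;> linarith

/-- A matrix commuting with a non-scalar `2 × 2` matrix `g` is a polynomial in `g`. -/
lemma exists_eq_add_smul_of_commute {g h : SL(2, ℝ)} (hg : g ≠ 1) (hg' : g ≠ -1)
    (hc : g * h = h * g) :
    ∃ p q : ℝ, (h : Matrix (Fin 2) (Fin 2) ℝ) = p • 1 + q • (g : Matrix (Fin 2) (Fin 2) ℝ) := by
  have hc' : ∀ i j, (g.1 * h.1) i j = (h.1 * g.1) i j := fun i j => by
    rw [← coe_mul, hc, coe_mul]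
  have h00 := hc' 0 0
  have h01 := hc' 0 1
  have h10 := hc' 1 0
  simp only [Matrix.mul_apply, Fin.sum_univ_two] at h00 h01 h10
  by_cases hb : g.1 0 1 = 0
  · by_cases hcc : g.1 1 0 = 0
    · have hd : g.1 0 0 - g.1 1 1 ≠ 0 := fun hd => by
        rcases eq_one_or_neg_one_of_entries hb hcc (sub_eq_zero.mp hd) with h | h
        exacts [hg h, hg' h]
      refine ⟨h.1 0 0 - (h.1 0 0 - h.1 1 1) / (g.1 0 0 - g.1 1 1) * g.1 0 0,
        (h.1 0 0 - h.1 1 1) / (g.1 0 0 - g.1 1 1), ?_⟩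
      rw [hb] at h01
      rw [hcc] at h10
      have e1 : h.1 0 1 = 0 := by
        apply mul_left_cancel₀ hd; linarith
      have e2 : h.1 1 0 = 0 := by
        apply mul_left_cancel₀ hd; linarith
      ext i j
      fin_cases i <;> fin_cases j <;> simp [e1, e2, hb, hcc]
      field_simp
      ring
    · refine ⟨h.1 0 0 - h.1 1 0 / g.1 1 0 * g.1 0 0, h.1 1 0 / g.1 1 0, ?_⟩
      ext i j
      fin_cases i <;> fin_cases j <;> simp <;> field_simp <;> linarith
  · refine ⟨h.1 0 0 - h.1 0 1 / g.1 0 1 * g.1 0 0, h.1 0 1 / g.1 0 1, ?_⟩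
    ext i j
    fin_cases i <;> fin_cases j <;> simp <;> field_simp <;> linarith

/-- The centralizer of a non-scalar element of `SL(2, ℝ)` is abelian. -/
lemma commute_of_commute {g a b : SL(2, ℝ)} (hg : g ≠ 1) (hg' : g ≠ -1)
    (ha : g * a = a * g) (hb : g * b = b * g) : a * b = b * a := by
  obtain ⟨p, q, h1⟩ := exists_eq_add_smul_of_commute hg hg' ha
  obtain ⟨p', q', h2⟩ := exists_eq_add_smul_of_commute hg hg' hb
  apply Subtype.ext
  rw [coe_mul, coe_mul, h1, h2]
  simp only [add_mul, mul_add, smul_mul_assoc, mul_smul_comm, one_mul, mul_one, smul_smul, smul_add]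
  rw [mul_comm p p', mul_comm q q', mul_comm p q', mul_comm q p']
  abel

/-- The Zassenhaus neighbourhood: the elements of a discrete group that are close to the identity
in a given frame commute, since the commutator of two of them is closer to the identity than
either, and there is a closest one. -/
lemma commute_of_disp_lt (Γ : Subgroup SL(2, ℝ)) [DiscreteTopology Γ] {τ α β : SL(2, ℝ)}
    (hα : α ∈ Γ) (hβ : β ∈ Γ) (hdα : disp τ α < 1 / 10) (hdβ : disp τ β < 1 / 10) :
    α * β = β * α := by
  by_cases hα1 : α = 1
  · simp [hα1]
  set S : Set SL(2, ℝ) := {γ | γ ∈ Γ ∧ γ ≠ 1 ∧ disp τ γ < 1 / 10} with hS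
  have hfin : S.Finite :=
    (finite_of_entries_le Γ _).subset fun γ hγ => ⟨hγ.1, entries_le_of_disp_le hγ.2.2.le⟩
  -- a shortest nontrivial element `g` commutes with all short elements, hence these lie in its
  -- centralizer, which is abelian
  obtain ⟨g, hgS, hmin⟩ := hfin.exists_minimalFor (disp τ) S ⟨α, hα, hα1, hdα⟩
  have key : ∀ h ∈ Γ, disp τ h < 1 / 10 → g * h = h * g := by
    intro h hh hdh
    by_contra hne
    set c := g * h * g⁻¹ * h⁻¹ with hc
    have hc1 : c ≠ 1 := fun h1 => hne (by
      have : g * h = c * (h * g) := by rw [hc]; simp [mul_assoc]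
      rw [this, h1, one_mul])
    have hlt : disp τ c < disp τ g := by
      have hconj : τ⁻¹ * c * τ = (τ⁻¹ * g * τ) * (τ⁻¹ * h * τ) * (τ⁻¹ * g * τ)⁻¹ *
          (τ⁻¹ * h * τ)⁻¹ := by rw [hc]; simp [mul_assoc]
      have hle := norm_commutator_sub_one_le (τ⁻¹ * g * τ) (τ⁻¹ * h * τ)
      rw [← hconj] at hle
      change disp τ c ≤ 2 * disp τ g * disp τ h * _ at hle
      have hn : ∀ γ, disp τ γ < 1 / 10 →
          ‖((τ⁻¹ * γ * τ : SL(2, ℝ)) : Matrix (Fin 2) (Fin 2) ℝ)‖ ≤ 8 / 5 := fun γ hγ => by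
        have := norm_add_le (((τ⁻¹ * γ * τ : SL(2, ℝ)) : Matrix (Fin 2) (Fin 2) ℝ) - 1) 1
        rw [sub_add_cancel] at this
        have := norm_one_le
        unfold disp at hγ
        linarith
      have hpos : 0 < disp τ g := disp_pos hgS.2.1
      calc disp τ c ≤ _ := hle
        _ ≤ 2 * disp τ g * (1 / 10) * (8 / 5 * (8 / 5)) := by
            gcongr
            · exact hn g hgS.2.2
            · exact hn h hdh
        _ < disp τ g := by nlinarith
    have hcS : c ∈ S := ⟨Γ.mul_mem (Γ.mul_mem (Γ.mul_mem hgS.1 hh) (Γ.inv_mem hgS.1))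
      (Γ.inv_mem hh), hc1, hlt.trans hgS.2.2⟩
    exact absurd (hmin hcS hlt.le) (not_le.mpr hlt)
  exact commute_of_commute hgS.2.1 (ne_neg_one_of_disp_lt hgS.2.2) (key α hα hdα) (key β hβ hdβ)

/-! ### Thick frames -/

/-- Among the elements `p + q γ` of a discrete group, the non-scalar ones have `|q|` bounded
below: the determinant condition bounds `p` in terms of `q`, so that only finitely many of them
have `|q| < 1`. -/
lemma exists_le_abs_coeff (Γ : Subgroup SL(2, ℝ)) [DiscreteTopology Γ] (γ : SL(2, ℝ)) :
    ∃ q₀ > 0, ∀ β ∈ Γ, β ≠ 1 → β ≠ -1 → ∀ p q : ℝ,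
      (β : Matrix (Fin 2) (Fin 2) ℝ) = p • 1 + q • (γ : Matrix (Fin 2) (Fin 2) ℝ) → q₀ ≤ |q| := by
  set t := γ.1 0 0 + γ.1 1 1 with ht
  set T : Set SL(2, ℝ) := {β | β ∈ Γ ∧ ∀ i j, |β.1 i j| ≤ 1 + |t| + ‖γ.1‖} with hT
  have hfin : T.Finite := finite_of_entries_le Γ _
  have hTq : ∃ q₀ > 0, ∀ β ∈ T, β ≠ 1 → β ≠ -1 → ∀ p q : ℝ,
      (β : Matrix (Fin 2) (Fin 2) ℝ) = p • 1 + q • (γ : Matrix (Fin 2) (Fin 2) ℝ) →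
        q₀ ≤ |q| := by
    -- `m` vanishes exactly on scalars and is homogeneous in `q` on the elements `p + q γ`
    set m : SL(2, ℝ) → ℝ := fun X => |X.1 0 1| + |X.1 1 0| + |X.1 0 0 - X.1 1 1| with hm
    have hmpos : ∀ X : SL(2, ℝ), X ≠ 1 → X ≠ -1 → 0 < m X := by
      intro X h1 h2
      by_contra hle
      have e1 : |X.1 0 1| = 0 := by
        have := abs_nonneg (X.1 0 1); have := abs_nonneg (X.1 1 0)
        have := abs_nonneg (X.1 0 0 - X.1 1 1); simp only [hm] at hle; linarith
      have e2 : |X.1 1 0| = 0 := by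
        have := abs_nonneg (X.1 0 1); have := abs_nonneg (X.1 1 0)
        have := abs_nonneg (X.1 0 0 - X.1 1 1); simp only [hm] at hle; linarith
      have e3 : |X.1 0 0 - X.1 1 1| = 0 := by
        have := abs_nonneg (X.1 0 1); have := abs_nonneg (X.1 1 0)
        have := abs_nonneg (X.1 0 0 - X.1 1 1); simp only [hm] at hle; linarith
      rcases eq_one_or_neg_one_of_entries (abs_eq_zero.mp e1) (abs_eq_zero.mp e2)
        (sub_eq_zero.mp (abs_eq_zero.mp e3)) with h | h
      exacts [h1 h, h2 h]
    have hmq : ∀ β : SL(2, ℝ), ∀ p q : ℝ,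
        (β : Matrix (Fin 2) (Fin 2) ℝ) = p • 1 + q • (γ : Matrix (Fin 2) (Fin 2) ℝ) →
          m β = |q| * m γ := by
      intro β p q h
      simp only [hm, h]
      simp only [Matrix.add_apply, Matrix.smul_apply, Matrix.one_apply, smul_eq_mul]
      simp only [Fin.isValue, zero_ne_one, one_ne_zero, ite_true, ite_false, mul_one, mul_zero,
        zero_add, abs_mul]
      rw [show p + q * γ.1 0 0 - (p + q * γ.1 1 1) = q * (γ.1 0 0 - γ.1 1 1) by ring, abs_mul]
      ring
    by_cases hne : ({β ∈ T | β ≠ 1 ∧ β ≠ -1}).Nonempty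
    · obtain ⟨β₀, hβ₀, hmin⟩ := (hfin.subset (Set.sep_subset T _)).exists_minimalFor m _ hne
      have hp := hmpos β₀ hβ₀.2.1 hβ₀.2.2
      have hγ0 : 0 ≤ m γ := by simp only [hm]; positivity
      refine ⟨m β₀ / (m γ + 1), by positivity, fun β hβ h1 h2 p q h => ?_⟩
      rw [div_le_iff₀ (by positivity)]
      have h3 : m β₀ ≤ m β := by
        by_contra hlt
        exact hlt (hmin ⟨hβ, h1, h2⟩ (not_le.mp hlt).le)
      rw [hmq β p q h] at h3
      nlinarith [abs_nonneg q]
    · exact ⟨1, one_pos, fun β hβ h1 h2 => absurd ⟨β, hβ, h1, h2⟩ hne⟩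
  obtain ⟨q₀, hq₀, hq⟩ := hTq
  refine ⟨min q₀ 1, by positivity, fun β hβ h1 h2 p q h => ?_⟩
  by_cases hq1 : 1 ≤ |q|
  · exact (min_le_right _ _).trans hq1
  refine (min_le_left _ _).trans (hq β ⟨hβ, fun i j => ?_⟩ h1 h2 p q h)
  have hdet := det_entries β
  have hdetγ := det_entries γ
  have hq1' : q ^ 2 ≤ 1 := by
    rw [← sq_abs]; have := abs_nonneg q; nlinarith
  have e : p ^ 2 + p * q * t + q ^ 2 = 1 := by
    rw [h] at hdet
    simp at hdet
    rw [ht]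
    linear_combination hdet - q ^ 2 * hdetγ
  have hp : |p| ≤ 1 + |t| := by
    have h4 : (p + q * t / 2) ^ 2 ≤ (1 + |t| / 2) ^ 2 := by
      have := sq_abs t
      have := abs_nonneg t
      nlinarith [mul_nonneg (sub_nonneg.mpr hq1') (sq_nonneg t), sq_nonneg q]
    have h5 : |p + q * t / 2| ≤ 1 + |t| / 2 := abs_le_of_sq_le_sq h4 (by positivity)
    have h6 : |q * t / 2| ≤ |t| / 2 := by
      rw [abs_div, abs_mul, abs_two]
      have := abs_nonneg t
      have := not_le.mp hq1
      gcongr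
      nlinarith
    calc |p| = |(p + q * t / 2) - q * t / 2| := by ring_nf
      _ ≤ |p + q * t / 2| + |q * t / 2| := abs_sub _ _
      _ ≤ _ := by linarith
  have hone : |(1 : Matrix (Fin 2) (Fin 2) ℝ) i j| ≤ 1 := by
    fin_cases i <;> fin_cases j <;> simp
  rw [h]
  calc |(p • (1 : Matrix (Fin 2) (Fin 2) ℝ) + q • γ.1) i j|
      = |p * (1 : Matrix (Fin 2) (Fin 2) ℝ) i j + q * γ.1 i j| := by simp
    _ ≤ |p| * |(1 : Matrix (Fin 2) (Fin 2) ℝ) i j| + |q| * |γ.1 i j| := by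
        rw [← abs_mul, ← abs_mul]; exact abs_add_le _ _
    _ ≤ |p| * 1 + 1 * ‖γ.1‖ := by
        gcongr
        · exact (not_le.mp hq1).le
        · exact abs_entry_le_norm _ _ _
    _ ≤ _ := by linarith

lemma exists_nat_le_abs_quadratic {A B : ℝ} (h : A ≠ 0 ∨ B ≠ 0) (C R : ℝ) :
    ∃ n : ℕ, R ≤ |C + n * B + n ^ 2 * A| := by
  by_cases hA : A = 0
  · have hB : 0 < |B| := abs_pos.mpr (h.resolve_left (not_not.mpr hA))
    obtain ⟨n, hn⟩ := exists_nat_ge ((R + |C|) / |B|)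
    refine ⟨n, ?_⟩
    rw [div_le_iff₀ hB] at hn
    have h1 := abs_sub_abs_le_abs_sub (n * B) (-C)
    rw [abs_mul, Nat.abs_cast, abs_neg] at h1
    rw [hA, show C + n * B + (n : ℝ) ^ 2 * 0 = n * B - -C by ring]
    linarith
  · have hA' : 0 < |A| := abs_pos.mpr hA
    obtain ⟨n, hn⟩ := exists_nat_ge ((|R| + |B| + |C|) / |A| + 1)
    refine ⟨n, ?_⟩
    have hn1 : (1 : ℝ) ≤ n := by
      have : 0 ≤ (|R| + |B| + |C|) / |A| := by positivity
      linarith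
    have hn2 : |R| + |B| + |C| ≤ n * |A| := by
      rw [← div_le_iff₀ hA']; linarith
    have h1 := abs_sub_abs_le_abs_sub ((n : ℝ) ^ 2 * A) (-(C + n * B))
    have h2 := abs_add_le C (n * B)
    rw [abs_mul, Nat.abs_cast] at h2
    rw [abs_mul, abs_neg, abs_pow, Nat.abs_cast] at h1
    rw [show C + n * B + (n : ℝ) ^ 2 * A = (n : ℝ) ^ 2 * A - -(C + n * B) by ring]
    have h3 : (n : ℝ) * (|R| + |B| + |C|) ≤ n ^ 2 * |A| := by nlinarith
    nlinarith [le_abs_self R, abs_nonneg R, abs_nonneg B, abs_nonneg C]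

/-- The lower triangular unipotent matrix with entry `x`. -/
def lowerUnip (x : ℝ) : SL(2, ℝ) := ⟨!![1, 0; x, 1], by simp⟩

/-- The upper triangular unipotent matrix with entry `x`. -/
def upperUnip (x : ℝ) : SL(2, ℝ) := ⟨!![1, x; 0, 1], by simp⟩

lemma coe_lowerUnip (x : ℝ) :
    (lowerUnip x : Matrix (Fin 2) (Fin 2) ℝ) = !![1, 0; x, 1] := rfl

lemma coe_upperUnip (x : ℝ) :
    (upperUnip x : Matrix (Fin 2) (Fin 2) ℝ) = !![1, x; 0, 1] := rfl

/-- A non-scalar matrix becomes large when it is conjugated by the powers of a suitable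
unipotent matrix. -/
lemma exists_unipotent_path {X : SL(2, ℝ)} (h1 : X ≠ 1) (h2 : X ≠ -1) :
    ∃ (s : ℕ → SL(2, ℝ)) (u : SL(2, ℝ)), s 0 = 1 ∧ (∀ n, s (n + 1) = s n * u) ∧
      ‖(u : Matrix (Fin 2) (Fin 2) ℝ)‖ ^ 2 = 3 ∧
      ∀ R : ℝ, ∃ n i j, i ≠ j ∧ R ≤ |((s n)⁻¹ * X * s n : SL(2, ℝ)).1 i j| := by
  by_cases hl : X.1 0 1 ≠ 0 ∨ X.1 1 1 - X.1 0 0 ≠ 0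
  · refine ⟨fun n => lowerUnip n, lowerUnip 1, ?_, ?_, ?_, ?_⟩
    · apply Subtype.ext
      simp [coe_lowerUnip, Matrix.one_fin_two]
    · intro n
      apply Subtype.ext
      rw [coe_mul, coe_lowerUnip, coe_lowerUnip, coe_lowerUnip]
      simp
    · rw [frobenius_sq, coe_lowerUnip]; simp; norm_num
    · intro R
      obtain ⟨n, hn⟩ := exists_nat_le_abs_quadratic (A := -X.1 0 1) (B := X.1 1 1 - X.1 0 0)
        (by simpa using hl) (X.1 1 0) R
      refine ⟨n, 1, 0, by simp, hn.trans_eq ?_⟩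
      rw [coe_mul, coe_mul, coe_inv_entries, coe_lowerUnip]
      simp [Matrix.mul_apply, Matrix.vecMul, dotProduct, Fin.sum_univ_two]
      ring_nf
  · push Not at hl
    have hc : X.1 1 0 ≠ 0 := fun hc => by
      rcases eq_one_or_neg_one_of_entries hl.1 hc (sub_eq_zero.mp hl.2).symm with h | h
      exacts [h1 h, h2 h]
    refine ⟨fun n => upperUnip n, upperUnip 1, ?_, ?_, ?_, ?_⟩
    · apply Subtype.ext
      simp [coe_upperUnip, Matrix.one_fin_two]
    · intro n
      apply Subtype.ext
      rw [coe_mul, coe_upperUnip, coe_upperUnip, coe_upperUnip]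
      simp [add_comm]
    · rw [frobenius_sq, coe_upperUnip]; simp; norm_num
    · intro R
      obtain ⟨n, hn⟩ := exists_nat_le_abs_quadratic (A := -X.1 1 0) (B := X.1 0 0 - X.1 1 1)
        (by simp [hc]) (X.1 0 1) R
      refine ⟨n, 0, 1, by simp, hn.trans_eq ?_⟩
      rw [coe_mul, coe_mul, coe_inv_entries, coe_upperUnip]
      simp [Matrix.mul_apply, Matrix.vecMul, dotProduct, Fin.sum_univ_two]
      ring_nf

/-- The frame `τ` is thick: no element of `Γ` other than `1` is close to the identity in it. -/
def IsThick (Γ : Subgroup SL(2, ℝ)) (τ : SL(2, ℝ)) : Prop :=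
  ∀ γ ∈ Γ, γ ≠ 1 → 1 / 30 ≤ disp τ γ

/-- From a thin frame one can move to a thick frame in which an element commuting with the given
short one is still short: the first frame along a unipotent path where the centralizer of `γ` in
`Γ` has no short elements. -/
lemma exists_thick_of_thin (Γ : Subgroup SL(2, ℝ)) [DiscreteTopology Γ] {τ γ : SL(2, ℝ)}
    (hγ : γ ∈ Γ) (hγ1 : γ ≠ 1) (hd : disp τ γ < 1 / 30) :
    ∃ τ' β, IsThick Γ τ' ∧ β ∈ Γ ∧ β ≠ 1 ∧ γ * β = β * γ ∧ disp τ' β < 1 / 10 := by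
  have hγ2 : γ ≠ -1 := ne_neg_one_of_disp_lt (hd.trans (by norm_num))
  set X := τ⁻¹ * γ * τ with hX
  have hX1 : X ≠ 1 := fun h => hγ1 (by
    calc γ = τ * X * τ⁻¹ := by rw [hX]; group
      _ = 1 := by rw [h]; group)
  have hX2 : X ≠ -1 := fun h => hγ2 (by
    calc γ = τ * X * τ⁻¹ := by rw [hX]; group
      _ = -1 := by rw [h]; simp)
  obtain ⟨s, u, hs0, hs, hu, hgrow⟩ := exists_unipotent_path hX1 hX2
  obtain ⟨q₀, hq₀, hq⟩ := exists_le_abs_coeff Γ γ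
  let P : ℕ → Prop := fun n => ∀ β ∈ Γ, β ≠ 1 → γ * β = β * γ → 1 / 30 ≤ disp (τ * s n) β
  -- an element `p + q γ` of the centralizer has off-diagonal entries `q` times those of `γ`, which
  -- become large along the path, while `|q|` is bounded below
  have hex : ∃ n, P n := by
    obtain ⟨n, i, j, hij, hn⟩ := hgrow (1 / q₀)
    refine ⟨n, fun β hβ hβ1 hc => ?_⟩
    by_contra hlt
    have hβ2 : β ≠ -1 := ne_neg_one_of_disp_lt ((not_le.mp hlt).trans (by norm_num))
    obtain ⟨p, q, hpq⟩ := exists_eq_add_smul_of_commute hγ1 hγ2 hc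
    have hqq := hq β hβ hβ1 hβ2 p q hpq
    have hconj : (((τ * s n)⁻¹ * β * (τ * s n) : SL(2, ℝ)) : Matrix (Fin 2) (Fin 2) ℝ) =
        p • 1 + q • (((s n)⁻¹ * X * s n : SL(2, ℝ)) : Matrix (Fin 2) (Fin 2) ℝ) := by
      have e : (s n)⁻¹ * X * s n = (τ * s n)⁻¹ * γ * (τ * s n) := by rw [hX]; group
      have e' : ((τ * s n)⁻¹ : SL(2, ℝ)).1 * (τ * s n : SL(2, ℝ)).1 = 1 := by
        rw [← coe_mul, inv_mul_cancel, coe_one]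
      rw [e, coe_mul, coe_mul _ β, hpq, coe_mul _ (τ * s n), coe_mul _ γ, mul_add, add_mul]
      simp only [mul_smul_comm, smul_mul_assoc, mul_one]
      rw [e']
    have hle := abs_entry_le_norm ((((τ * s n)⁻¹ * β * (τ * s n) : SL(2, ℝ)) :
      Matrix (Fin 2) (Fin 2) ℝ) - 1) i j
    change _ ≤ disp (τ * s n) β at hle
    rw [hconj, Matrix.sub_apply, Matrix.add_apply, Matrix.smul_apply, Matrix.smul_apply,
      Matrix.one_apply_ne hij, smul_zero, zero_add, sub_zero, smul_eq_mul, abs_mul] at hle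
    have : 1 ≤ |q| * |((s n)⁻¹ * X * s n : SL(2, ℝ)).1 i j| := by
      calc (1 : ℝ) = q₀ * (1 / q₀) := by field_simp
        _ ≤ _ := by gcongr
    linarith
  classical
  have hmin := Nat.find_spec hex
  have hlt := fun m => Nat.find_min hex (m := m)
  set n := Nat.find hex
  have hn0 : n ≠ 0 := fun h0 => by
    have := hmin γ hγ hγ1 rfl
    rw [h0, hs0, mul_one] at this
    linarith
  obtain ⟨m, hm⟩ := Nat.exists_eq_succ_of_ne_zero hn0
  have hPm := hlt m (by omega)
  simp only [P, not_forall, not_le] at hPm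
  obtain ⟨β, hβ, hβ1, hβc, hβd⟩ := hPm
  -- `β` is short one step before, and a step multiplies displacements by at most `‖u‖ ^ 2 = 3`
  have hdβ : disp (τ * s n) β < 1 / 10 := by
    have := disp_mul_right_le (τ * s m) u β
    rw [mul_assoc, ← hs m, hu] at this
    rw [hm]
    linarith
  refine ⟨τ * s n, β, fun α hα hα1 => ?_, hβ, hβ1, hβc, hdβ⟩
  -- any element short in the new frame commutes with `β`, hence with `γ`
  by_contra hα2
  have hdα : disp (τ * s n) α < 1 / 10 := (not_le.mp hα2).trans (by norm_num)
  have hαβ := commute_of_disp_lt Γ hβ hα hdβ hdα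
  exact hα2 (hmin α hα hα1
    (commute_of_commute hβ1 (ne_neg_one_of_disp_lt hdβ) hβc.symm hαβ))

end Frames

/-! ### Thick frames are bounded modulo a group of finite covolume -/

instance : SMulInvariantMeasure SL(2, ℝ) ℍ volume where
  measure_preimage_smul g s hs := by
    have := measure_preimage_smul (volume : Measure ℍ) (mapGL ℝ g) s
    exact this

/-- The group of transformations of `ℍ` induced by `Γ`. -/
abbrev transfGroup (Γ : Subgroup SL(2, ℝ)) : Subgroup (Equiv.Perm ℍ) :=
  Γ.map (MulAction.toPermHom SL(2, ℝ) ℍ)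

lemma exists_smul_eq (Γ : Subgroup SL(2, ℝ)) (g : transfGroup Γ) :
    ∃ γ ∈ Γ, ∀ z : ℍ, g • z = γ • z := by
  obtain ⟨γ, hγ, h⟩ := g.2
  exact ⟨γ, hγ, fun z => by rw [Subgroup.smul_def, ← h]; rfl⟩

instance (Γ : Subgroup SL(2, ℝ)) : MeasurableConstSMul (transfGroup Γ) ℍ where
  measurable_const_smul g := by
    obtain ⟨γ, -, h⟩ := exists_smul_eq Γ g
    have : (g • · : ℍ → ℍ) = (γ • ·) := funext h
    rw [this]; exact measurable_const_smul γ

instance (Γ : Subgroup SL(2, ℝ)) : SMulInvariantMeasure (transfGroup Γ) ℍ volume where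
  measure_preimage_smul g s hs := by
    obtain ⟨γ, -, h⟩ := exists_smul_eq Γ g
    have : (g • · : ℍ → ℍ) = (γ • ·) := funext h
    rw [this]; exact measure_preimage_smul volume γ s

instance (Γ : Subgroup SL(2, ℝ)) [DiscreteTopology Γ] : Countable (transfGroup Γ) := by
  have : SecondCountableTopology (Matrix (Fin 2) (Fin 2) ℝ) :=
    inferInstanceAs (SecondCountableTopology (Fin 2 → Fin 2 → ℝ))
  have : SecondCountableTopology SL(2, ℝ) :=
    Matrix.SpecialLinearGroup.isClosedEmbedding_val.isEmbedding.secondCountableTopology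
  have : Countable Γ := TopologicalSpace.separableSpace_iff_countable.mp inferInstance
  have hc : (Γ : Set SL(2, ℝ)).Countable := Set.countable_coe_iff.mp this
  exact Set.countable_coe_iff.mpr (hc.image (MulAction.toPermHom SL(2, ℝ) ℍ))

instance : Measure.IsOpenPosMeasure (volume : Measure ℍ) where
  open_pos U hU hne := by
    rw [volume_eq_lintegral]
    have hU' : IsOpen ((↑) '' U : Set ℂ) := isOpenEmbedding_coe.isOpenMap U hU
    apply ne_of_gt
    rw [setLIntegral_pos_iff (by fun_prop)]
    have : Function.support (fun z : ℂ => (((1 / ‖z.im‖₊) ^ 2 : NNReal) : ENNReal)) ∩ (↑) '' U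
        = ((↑) '' U : Set ℂ) := by
      rw [Set.inter_eq_right]
      rintro _ ⟨z, -, rfl⟩
      simp [z.im_ne_zero]
    rw [this]
    exact hU'.measure_pos _ (hne.image _)

lemma exists_entries_le_of_isCompact {K : Set ℍ} (hK : IsCompact K) :
    ∃ R, ∀ g : SL(2, ℝ), g • I ∈ K → ∀ i j, |g.1 i j| ≤ R := by
  have hc := isProperMap_smul_I.isCompact_preimage hK
  have : ∀ i j : Fin 2, ∃ R, ∀ g : SL(2, ℝ), g • I ∈ K → |g.1 i j| ≤ R := fun i j => by
    have hcont : Continuous fun g : SL(2, ℝ) => g.1 i j :=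
      continuous_subtype_val.matrix_elem i j
    obtain ⟨R, hR⟩ := hc.exists_bound_of_continuousOn hcont.continuousOn
    exact ⟨R, fun g hg => hR g hg⟩
  choose R hR using this
  refine ⟨∑ i, ∑ j, |R i j|, fun g hg i j => ((hR i j g hg).trans (le_abs_self _)).trans ?_⟩
  exact (Finset.single_le_sum (f := fun j => |R i j|) (fun _ _ => abs_nonneg _)
    (Finset.mem_univ j)).trans (Finset.single_le_sum (f := fun i => ∑ j, |R i j|)
    (fun _ _ => Finset.sum_nonneg fun _ _ => abs_nonneg _) (Finset.mem_univ i))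

lemma dist_conj_smul (τ γ : SL(2, ℝ)) :
    dist ((τ⁻¹ * γ * τ) • I) I = dist (γ • τ • I) (τ • I) := by
  rw [← dist_smul τ ((τ⁻¹ * γ * τ) • I) I, smul_smul, smul_smul]
  congr 2; group

open scoped Matrix.Norms.Frobenius in
/-- In a thick frame the number of elements of `Γ` that move the base point by a bounded amount is
bounded: in that frame they are separated points of a compact set. -/
lemma exists_card_le_of_thick (Γ : Subgroup SL(2, ℝ)) (r : ℝ) :
    ∃ M : ℕ, ∀ τ, IsThick Γ τ → ∀ F : Finset SL(2, ℝ),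
      (∀ γ ∈ F, γ ∈ Γ ∧ dist (γ • τ • I) (τ • I) ≤ r) → F.card ≤ M := by
  obtain ⟨R, hR⟩ := exists_entries_le_of_isCompact (isCompact_closedBall I r)
  have hR0 : 0 ≤ |R| := abs_nonneg R
  -- two matrices with entries at most `R` in a common cell of this mesh differ by a factor that
  -- is within `1 / 30` of the identity
  set k : ℝ := 120 * |R| + 1 with hk
  have hk0 : 0 < k := by positivity
  set N : ℤ := ⌈|R| * k⌉ + 1 with hN
  set box : Finset (Fin 2 × Fin 2 → ℤ) := Finset.Icc (fun _ => -N) (fun _ => N) with hbox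
  refine ⟨box.card, fun τ hτ F hF => ?_⟩
  set cell : SL(2, ℝ) → (Fin 2 × Fin 2 → ℤ) :=
    fun γ p => ⌊(τ⁻¹ * γ * τ).1 p.1 p.2 * k⌋ with hcell
  have hent : ∀ γ ∈ F, ∀ i j, |(τ⁻¹ * γ * τ).1 i j| ≤ |R| := fun γ hγ i j =>
    (hR _ (by rw [Metric.mem_closedBall, dist_conj_smul]; exact (hF γ hγ).2) i j).trans
      (le_abs_self R)
  refine Finset.card_le_card_of_injOn cell (fun γ hγ => ?_) (fun γ hγ γ' hγ' heq => ?_)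
  · have h1 := fun p : Fin 2 × Fin 2 => abs_le.mp (hent γ hγ p.1 p.2)
    have h2 : |R| * k ≤ N - 1 := by rw [hN]; push_cast; linarith [Int.le_ceil (|R| * k)]
    rw [Finset.mem_coe, hbox, Finset.mem_Icc]
    constructor
    · intro p
      apply Int.le_floor.mpr
      have := (h1 p).1
      push_cast
      nlinarith
    · intro p
      apply Int.floor_le_iff.mpr
      have := (h1 p).2
      nlinarith
  · by_contra hne
    set x := τ⁻¹ * γ * τ with hx
    set y := τ⁻¹ * γ' * τ with hy
    have hthick := hτ (γ⁻¹ * γ') (Γ.mul_mem (Γ.inv_mem (hF γ hγ).1) (hF γ' hγ').1)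
      (fun h => hne (inv_mul_eq_one.mp h))
    have hxy : τ⁻¹ * (γ⁻¹ * γ') * τ = x⁻¹ * y := by rw [hx, hy]; group
    have hdiff : ∀ i j, |(y.1 - x.1) i j| ≤ 1 / k := by
      intro i j
      have h1 : ⌊x.1 i j * k⌋ = ⌊y.1 i j * k⌋ := congrFun heq (i, j)
      have h2 := Int.abs_sub_lt_one_of_floor_eq_floor h1
      rw [← sub_mul, abs_mul, abs_of_pos hk0, abs_sub_comm] at h2
      rw [le_div_iff₀ hk0, Matrix.sub_apply]
      exact h2.le
    have h3 := norm_le_of_entries hdiff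
    have h4 := norm_le_of_entries (hent γ hγ)
    rw [← hx] at h4
    have h5 : (x⁻¹ * y : SL(2, ℝ)).1 - 1 = (x⁻¹ : SL(2, ℝ)).1 * (y.1 - x.1) := by
      rw [mul_sub, ← coe_mul, ← coe_mul, inv_mul_cancel, coe_one]
    rw [disp, hxy, h5] at hthick
    have h6 := norm_mul_le (x⁻¹ : SL(2, ℝ)).1 (y.1 - x.1)
    rw [norm_coe_inv] at h6
    have h7 : ‖x.1‖ * ‖y.1 - x.1‖ ≤ (2 * |R|) * (2 * (1 / k)) := by gcongr
    have h8 : (2 * |R|) * (2 * (1 / k)) < 1 / 30 := by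
      rw [show (2 * |R|) * (2 * (1 / k)) = 4 * |R| / k by ring, div_lt_iff₀ hk0]
      linarith
    linarith

/-- Packing: the projections to the quotient of balls around thick points that are separated modulo
`Γ` do not overlap, and are at most `M` to `1`. -/
lemma card_mul_volume_ball_le (Γ : Subgroup SL(2, ℝ)) [DiscreteTopology Γ] {D : Set ℍ}
    (hD : IsFundDomain Γ D) {r : ℝ} {M : ℕ}
    (hM : ∀ τ, IsThick Γ τ → ∀ F : Finset SL(2, ℝ),
      (∀ γ ∈ F, γ ∈ Γ ∧ dist (γ • τ • I) (τ • I) ≤ 2 * r) → F.card ≤ M)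
    (t : Finset SL(2, ℝ)) (ht : ∀ τ ∈ t, IsThick Γ τ)
    (hsep : ∀ τ ∈ t, ∀ τ' ∈ t, τ ≠ τ' → ∀ γ ∈ Γ, 2 * r ≤ dist (γ • τ • I) (τ' • I)) :
    t.card * volume (Metric.ball I r) ≤ M * volume D := by
  classical
  set f : ℍ → ENNReal := fun z => ∑ τ ∈ t, (Metric.ball (τ • I) r).indicator 1 z with hf
  have hmeas : Measurable f := by
    refine Finset.measurable_fun_sum t fun τ _ => ?_
    exact measurable_one.indicator Metric.isOpen_ball.measurableSet
  have h1 : ∫⁻ z, f z = t.card * volume (Metric.ball I r) := by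
    rw [hf, lintegral_finsetSum]
    · rw [Finset.sum_congr rfl (g := fun _ => volume (Metric.ball I r)), Finset.sum_const,
        nsmul_eq_mul]
      intro τ _
      rw [lintegral_indicator_one Metric.isOpen_ball.measurableSet, ← Metric.smul_ball,
        measure_smul]
    · intro τ _
      exact measurable_one.indicator Metric.isOpen_ball.measurableSet
  rw [← h1, hD.lintegral_eq_tsum'', ← lintegral_tsum
    (f := fun (g : transfGroup Γ) z => f (g • z))
    (fun g => (hmeas.comp (measurable_const_smul g)).aemeasurable)]
  rw [← setLIntegral_const]
  refine lintegral_mono fun z => ?_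
  rw [ENNReal.tsum_eq_iSup_sum]
  refine iSup_le fun s => ?_
  choose lift hliftΓ hlift using exists_smul_eq Γ
  -- all incidences at `z` involve the same ball, and the transformations differ by elements of `Γ`
  -- that move its centre by at most `2 r`
  set Q := (s ×ˢ t).filter fun p => p.1 • z ∈ Metric.ball (p.2 • I) r with hQ
  have h2 : ∑ g ∈ s, f (g • z) = Q.card := by
    rw [hQ, Finset.card_filter, Finset.sum_product]
    push_cast
    refine Finset.sum_congr rfl fun g _ => Finset.sum_congr rfl fun τ _ => ?_
    simp [Set.indicator_apply]
  rw [h2]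
  norm_cast
  rcases Q.eq_empty_or_nonempty with h0 | ⟨⟨g₀, τ₀⟩, h0⟩
  · simp [h0]
  have hmem : ∀ p ∈ Q, p.2 = τ₀ ∧ dist ((lift p.1 * (lift g₀)⁻¹) • τ₀ • I) (τ₀ • I) ≤ 2 * r := by
    rintro ⟨g, τ⟩ hp
    rw [hQ, Finset.mem_filter, Finset.mem_product, Metric.mem_ball] at hp h0
    have h3 : dist ((lift g * (lift g₀)⁻¹) • τ₀ • I) (τ • I) < 2 * r := by
      have e1 : dist ((lift g * (lift g₀)⁻¹) • τ₀ • I) (g • z) < r := by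
        have : g • z = (lift g * (lift g₀)⁻¹) • g₀ • z := by
          rw [hlift, hlift, smul_smul]; simp
        rw [this, dist_smul, dist_comm]; exact h0.2
      have := dist_triangle ((lift g * (lift g₀)⁻¹) • τ₀ • I) (g • z) (τ • I)
      have := hp.2
      linarith
    have h4 : τ = τ₀ := by
      by_contra hne
      exact absurd (hsep τ₀ h0.1.2 τ hp.1.2 (Ne.symm hne) _
        (Γ.mul_mem (hliftΓ g) (Γ.inv_mem (hliftΓ g₀)))) (not_le.mpr h3)
    exact ⟨h4, h4 ▸ h3.le⟩
  have hτ₀ : τ₀ ∈ t := (Finset.mem_product.mp (Finset.mem_filter.mp h0).1).2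
  have hinj : Set.InjOn (fun p : transfGroup Γ × SL(2, ℝ) => lift p.1 * (lift g₀)⁻¹) Q := by
    rintro ⟨g, τ⟩ hp ⟨g', τ'⟩ hp' h
    have h5 : lift g = lift g' := mul_right_cancel h
    have h6 : g = g' := by
      apply Subtype.ext
      ext1 w
      have := hlift g w
      rw [h5, ← hlift g' w] at this
      exact this
    exact Prod.ext h6 ((hmem _ hp).1.trans (hmem _ hp').1.symm)
  rw [← Finset.card_image_of_injOn hinj]
  refine hM τ₀ (ht τ₀ hτ₀) _ fun γ hγ => ?_
  obtain ⟨p, hp, rfl⟩ := Finset.mem_image.mp hγ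
  exact ⟨Γ.mul_mem (hliftΓ _) (Γ.inv_mem (hliftΓ _)), (hmem p hp).2⟩

/-- The thick frames of a group of finite covolume are bounded modulo the group. -/
lemma exists_entries_le_of_thick (Γ : Subgroup SL(2, ℝ)) [DiscreteTopology Γ] {D : Set ℍ}
    (hD : IsFundDomain Γ D) (hvol : volume D < ⊤) :
    ∃ R, ∀ τ, IsThick Γ τ → ∃ δ ∈ Γ, ∀ i j, |(δ * τ).1 i j| ≤ R := by
  classical
  -- a maximal set of thick frames over points that are `2`-separated modulo `Γ` is finite, and
  -- every thick frame lies over a point at distance at most `2` from one of them modulo `Γ`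
  obtain ⟨M, hM⟩ := exists_card_le_of_thick Γ (2 * 1)
  set P : Set (Finset SL(2, ℝ)) := {t | (∀ τ ∈ t, IsThick Γ τ) ∧
    ∀ τ ∈ t, ∀ τ' ∈ t, τ ≠ τ' → ∀ γ ∈ Γ, 2 * 1 ≤ dist (γ • τ • I) (τ' • I)} with hP
  have hv : volume (Metric.ball I 1) ≠ 0 := (Metric.measure_ball_pos volume I one_pos).ne'
  have hfin : (M * volume D) / volume (Metric.ball I 1) ≠ ⊤ :=
    ENNReal.div_ne_top (ENNReal.mul_ne_top (by simp) hvol.ne) hv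
  have hv' : volume (Metric.ball I 1) ≠ ⊤ :=
    ((measure_mono Metric.ball_subset_closedBall).trans_lt
      (isCompact_closedBall I 1).measure_lt_top).ne
  obtain ⟨B, hB⟩ := ENNReal.exists_nat_gt hfin
  have hbdd : BddAbove (Finset.card '' P) := by
    refine ⟨B, ?_⟩
    rintro _ ⟨t, ht, rfl⟩
    have h1 := card_mul_volume_ball_le Γ hD hM t ht.1 ht.2
    rw [← ENNReal.le_div_iff_mul_le (Or.inl hv) (Or.inl hv')] at h1
    exact_mod_cast (h1.trans_lt hB).le
  obtain ⟨t, ht, hmax⟩ := Nat.sSup_mem (s := Finset.card '' P)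
    ⟨_, ∅, by simp [hP], rfl⟩ hbdd
  have hK : IsCompact (⋃ τ ∈ t, Metric.closedBall (τ • I) 2) :=
    t.isCompact_biUnion fun τ _ => isCompact_closedBall _ _
  obtain ⟨R, hR⟩ := exists_entries_le_of_isCompact hK
  refine ⟨R, fun τ hτ => ?_⟩
  suffices h : ∃ δ ∈ Γ, ∃ τ' ∈ t, dist (δ • τ • I) (τ' • I) ≤ 2 by
    obtain ⟨δ, hδ, τ', hτ', hd⟩ := h
    refine ⟨δ, hδ, hR (δ * τ) ?_⟩
    rw [mul_smul]
    exact Set.mem_biUnion hτ' hd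
  by_contra hno
  push Not at hno
  have hnot : τ ∉ t := fun hmem => by
    have := hno 1 Γ.one_mem τ hmem
    simp at this
    linarith
  have hins : insert τ t ∈ P := by
    refine ⟨fun τ' hτ' => ?_, fun τ₁ h₁ τ₂ h₂ hne γ hγ => ?_⟩
    · rcases Finset.mem_insert.mp hτ' with rfl | h
      exacts [hτ, ht.1 _ h]
    · rcases Finset.mem_insert.mp h₁ with rfl | h₁' <;>
        rcases Finset.mem_insert.mp h₂ with rfl | h₂'
      · exact absurd rfl hne
      · have := hno γ hγ τ₂ h₂'; linarith
      · have := hno γ⁻¹ (Γ.inv_mem hγ) τ₁ h₁'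
        rw [← dist_smul γ, smul_inv_smul, dist_comm] at this
        linarith
      · exact ht.2 _ h₁' _ h₂' hne γ hγ
  have := le_csSup hbdd (Set.mem_image_of_mem Finset.card hins)
  rw [← hmax, Finset.card_insert_of_notMem hnot] at this
  omega

section ThinFrames

open scoped Matrix.Norms.Frobenius

/-! ### Thin frames around elliptic and hyperbolic elements -/

lemma conj_entries (τ β : SL(2, ℝ)) :
    ((τ⁻¹ * β * τ : SL(2, ℝ)) : Matrix (Fin 2) (Fin 2) ℝ) =
      !![τ.1 1 1 * (β.1 0 0 * τ.1 0 0 + β.1 0 1 * τ.1 1 0) -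
          τ.1 0 1 * (β.1 1 0 * τ.1 0 0 + β.1 1 1 * τ.1 1 0),
        τ.1 1 1 * (β.1 0 0 * τ.1 0 1 + β.1 0 1 * τ.1 1 1) -
          τ.1 0 1 * (β.1 1 0 * τ.1 0 1 + β.1 1 1 * τ.1 1 1);
        τ.1 0 0 * (β.1 1 0 * τ.1 0 0 + β.1 1 1 * τ.1 1 0) -
          τ.1 1 0 * (β.1 0 0 * τ.1 0 0 + β.1 0 1 * τ.1 1 0),
        τ.1 0 0 * (β.1 1 0 * τ.1 0 1 + β.1 1 1 * τ.1 1 1) -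
          τ.1 1 0 * (β.1 0 0 * τ.1 0 1 + β.1 0 1 * τ.1 1 1)] := by
  rw [mul_assoc, coe_mul, coe_mul, coe_inv_entries]
  ext i j
  fin_cases i <;> fin_cases j <;>
    simp [Matrix.mul_apply, Fin.sum_univ_two] <;> ring

/-- If some element of `Γ` commuting with `β` is short in the frame `τ`, then `τ⁻¹ β τ` is bounded
up to scalar matrices, independently of `τ`. -/
lemma exists_conj_le (Γ : Subgroup SL(2, ℝ)) [DiscreteTopology Γ] {β : SL(2, ℝ)}
    (hβ1 : β ≠ 1) (hβ2 : β ≠ -1) :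
    ∃ R, ∀ τ, ∀ γ ∈ Γ, γ ≠ 1 → β * γ = γ * β → disp τ γ < 1 / 30 →
      |(τ⁻¹ * β * τ).1 0 1| ≤ R ∧ |(τ⁻¹ * β * τ).1 1 0| ≤ R ∧
        |(τ⁻¹ * β * τ).1 0 0 - (τ⁻¹ * β * τ).1 1 1| ≤ R := by
  obtain ⟨q₀, hq₀, hq⟩ := exists_le_abs_coeff Γ β
  refine ⟨1 / q₀, fun τ γ hγ hγ1 hc hd => ?_⟩
  have hγ2 : γ ≠ -1 := ne_neg_one_of_disp_lt (hd.trans (by norm_num))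
  obtain ⟨p, q, hpq⟩ := exists_eq_add_smul_of_commute hβ1 hβ2 hc
  have hqq := hq γ hγ hγ1 hγ2 p q hpq
  set X := τ⁻¹ * β * τ with hX
  have hconj : (τ⁻¹ * γ * τ : SL(2, ℝ)).1 = p • 1 + q • X.1 := by
    have e' : (τ⁻¹ : SL(2, ℝ)).1 * τ.1 = 1 := by rw [← coe_mul, inv_mul_cancel, coe_one]
    rw [hX, coe_mul, coe_mul _ γ, hpq, coe_mul _ τ, coe_mul _ β, mul_add, add_mul]
    simp only [mul_smul_comm, smul_mul_assoc, mul_one]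
    rw [e']
  have hle := fun i j => (abs_entry_le_norm ((τ⁻¹ * γ * τ : SL(2, ℝ)).1 - 1) i j).trans hd.le
  rw [hconj] at hle
  have h01 := hle 0 1
  have h10 := hle 1 0
  have h00 := abs_le.mp (hle 0 0)
  have h11 := abs_le.mp (hle 1 1)
  simp at h01 h10 h00 h11
  have key : ∀ x : ℝ, |q * x| ≤ 1 → |x| ≤ 1 / q₀ := fun x hx => by
    rw [le_div_iff₀ hq₀]
    rw [abs_mul] at hx
    nlinarith [abs_nonneg x]
  refine ⟨key _ ?_, key _ ?_, key _ ?_⟩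
  · rw [abs_mul]; exact h01.trans (by norm_num)
  · rw [abs_mul]; exact h10.trans (by norm_num)
  · rw [abs_le, mul_sub]; constructor <;> linarith [h00.1, h00.2, h11.1, h11.2]

/-- Around an elliptic element the thin frames are bounded: a definite quadratic form is bounded
on the columns of the frame. -/
lemma exists_entries_le_of_elliptic {β : SL(2, ℝ)} (ht : (β.1 0 0 + β.1 1 1) ^ 2 < 4) (R : ℝ) :
    ∃ R', ∀ τ : SL(2, ℝ), |(τ⁻¹ * β * τ).1 0 1| ≤ R → |(τ⁻¹ * β * τ).1 1 0| ≤ R →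
      ∀ i j, |τ.1 i j| ≤ R' := by
  set Δ := 4 - (β.1 0 0 + β.1 1 1) ^ 2 with hΔ
  have hΔ0 : 0 < Δ := by linarith
  have hdet := det_entries β
  set a := β.1 0 0
  set b := β.1 0 1
  set c := β.1 1 0
  set d := β.1 1 1
  have key : ∀ x y : ℝ, |c * x ^ 2 + (d - a) * x * y - b * y ^ 2| ≤ R →
      x ^ 2 ≤ 4 * (|b| + |c|) * R / Δ ∧ y ^ 2 ≤ 4 * (|b| + |c|) * R / Δ := by
    intro x y h
    have hR : 0 ≤ R := (abs_nonneg _).trans h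
    set Q := c * x ^ 2 + (d - a) * x * y - b * y ^ 2 with hQ
    have e1 : Δ * y ^ 2 + (2 * c * x + (d - a) * y) ^ 2 = 4 * (c * Q) := by
      rw [hΔ, hQ]; linear_combination (-4 * y ^ 2) * hdet
    have e2 : Δ * x ^ 2 + (2 * b * y - (d - a) * x) ^ 2 = 4 * (-b * Q) := by
      rw [hΔ, hQ]; linear_combination (-4 * x ^ 2) * hdet
    have h1 : c * Q ≤ |c| * R := by
      calc c * Q ≤ |c * Q| := le_abs_self _
        _ ≤ |c| * R := by rw [abs_mul]; gcongr
    have h2 : -b * Q ≤ |b| * R := by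
      calc -b * Q ≤ |-b * Q| := le_abs_self _
        _ ≤ |b| * R := by rw [abs_mul, abs_neg]; gcongr
    constructor
    · rw [le_div_iff₀ hΔ0]
      nlinarith [sq_nonneg (2 * b * y - (d - a) * x), mul_nonneg (abs_nonneg c) hR]
    · rw [le_div_iff₀ hΔ0]
      nlinarith [sq_nonneg (2 * c * x + (d - a) * y), mul_nonneg (abs_nonneg b) hR]
  have hsq : ∀ x B : ℝ, x ^ 2 ≤ B → |x| ≤ B + 1 := fun x B h => by
    have := sq_abs x
    nlinarith [sq_nonneg (|x| - 1)]
  refine ⟨4 * (|b| + |c|) * R / Δ + 1, fun τ h01 h10 => ?_⟩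
  rw [conj_entries] at h01 h10
  simp only [Matrix.of_apply, Matrix.cons_val] at h01 h10
  have k1 := key (τ.1 0 0) (τ.1 1 0) (by
    rw [← show τ.1 0 0 * (c * τ.1 0 0 + d * τ.1 1 0) - τ.1 1 0 * (a * τ.1 0 0 + b * τ.1 1 0) =
      c * τ.1 0 0 ^ 2 + (d - a) * τ.1 0 0 * τ.1 1 0 - b * τ.1 1 0 ^ 2 by ring]
    exact h10)
  have k2 := key (τ.1 0 1) (τ.1 1 1) (by
    rw [← abs_neg, ← show τ.1 1 1 * (a * τ.1 0 1 + b * τ.1 1 1) -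
      τ.1 0 1 * (c * τ.1 0 1 + d * τ.1 1 1) =
      -(c * τ.1 0 1 ^ 2 + (d - a) * τ.1 0 1 * τ.1 1 1 - b * τ.1 1 1 ^ 2) by ring]
    exact h01)
  intro i j
  fin_cases i <;> fin_cases j
  · exact hsq _ _ k1.1
  · exact hsq _ _ k2.1
  · exact hsq _ _ k1.2
  · exact hsq _ _ k2.2

lemma exists_root_of_hyperbolic {t : ℝ} (ht : 4 < t ^ 2) :
    ∃ l : ℝ, 1 < |l| ∧ l ^ 2 - t * l + 1 = 0 := by
  have hs : 0 < t ^ 2 - 4 := by linarith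
  set s := √(t ^ 2 - 4) with hsd
  have hs1 : 0 < s := Real.sqrt_pos.mpr hs
  have hs2 : s ^ 2 = t ^ 2 - 4 := Real.sq_sqrt hs.le
  rcases le_or_gt 0 t with h | h
  · have h2 : 2 < t := by nlinarith
    exact ⟨(t + s) / 2, by rw [abs_of_pos (by linarith)]; linarith, by nlinarith⟩
  · have h2 : t < -2 := by nlinarith
    exact ⟨(t - s) / 2, by rw [abs_of_neg (by linarith)]; linarith, by nlinarith⟩

lemma exists_left_eigenvector {β : SL(2, ℝ)} {l : ℝ}
    (hl : l ^ 2 - (β.1 0 0 + β.1 1 1) * l + 1 = 0) :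
    ∃ v : Fin 2 → ℝ, v ≠ 0 ∧ Matrix.vecMul v β.1 = l • v := by
  have hdet : (β.1 - l • (1 : Matrix (Fin 2) (Fin 2) ℝ)).det = 0 := by
    rw [Matrix.det_fin_two]
    simp
    linear_combination hl + det_entries β
  obtain ⟨v, hv, h⟩ := Matrix.exists_vecMul_eq_zero_iff.mpr hdet
  refine ⟨v, hv, ?_⟩
  rw [Matrix.vecMul_sub, sub_eq_zero] at h
  rw [h, Matrix.vecMul_smul, Matrix.vecMul_one]

lemma vecMul_zpow {β : SL(2, ℝ)} {l : ℝ} (hl : l ≠ 0) {v : Fin 2 → ℝ}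
    (h : Matrix.vecMul v β.1 = l • v) (n : ℤ) :
    Matrix.vecMul v (β ^ n : SL(2, ℝ)).1 = l ^ n • v := by
  have hinv : Matrix.vecMul v (β⁻¹ : SL(2, ℝ)).1 = l⁻¹ • v := by
    have h1 : Matrix.vecMul (Matrix.vecMul v β.1) (β⁻¹ : SL(2, ℝ)).1 = v := by
      rw [Matrix.vecMul_vecMul, ← coe_mul, mul_inv_cancel, coe_one, Matrix.vecMul_one]
    rw [h, Matrix.smul_vecMul] at h1
    rw [← h1, smul_smul, inv_mul_cancel₀ hl, one_smul, h1]
  induction n using Int.induction_on with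
  | zero => simp
  | succ n ih =>
    rw [zpow_add_one, coe_mul, ← Matrix.vecMul_vecMul, ih, Matrix.smul_vecMul, h, smul_smul,
      zpow_add_one₀ hl]
  | pred n ih =>
    rw [zpow_sub_one, coe_mul, ← Matrix.vecMul_vecMul, ih, Matrix.smul_vecMul, hinv, smul_smul,
      zpow_sub_one₀ hl]

lemma vecMul_fin_two (v : Fin 2 → ℝ) (M : Matrix (Fin 2) (Fin 2) ℝ) (j : Fin 2) :
    Matrix.vecMul v M j = v 0 * M 0 j + v 1 * M 1 j := by
  simp [Matrix.vecMul, dotProduct, Fin.sum_univ_two]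

lemma det_ne_zero_of_left_eigenvectors {M : Matrix (Fin 2) (Fin 2) ℝ} {l m : ℝ} (hne : l - m ≠ 0)
    {v w : Fin 2 → ℝ} (hv0 : v ≠ 0) (hw0 : w ≠ 0) (hv : Matrix.vecMul v M = l • v)
    (hw : Matrix.vecMul w M = m • w) : v 0 * w 1 - v 1 * w 0 ≠ 0 := by
  have ev0 := congrFun hv 0
  have ev1 := congrFun hv 1
  have ew0 := congrFun hw 0
  have ew1 := congrFun hw 1
  rw [vecMul_fin_two, Pi.smul_apply, smul_eq_mul] at ev0 ev1 ew0 ew1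
  intro h
  have h0 : (l - m) * (v 0 * w 0) = 0 := by
    linear_combination -w 0 * ev0 + v 0 * ew0 - M 1 0 * h
  have h1 : (l - m) * (v 1 * w 1) = 0 := by
    linear_combination -w 1 * ev1 + v 1 * ew1 + M 0 1 * h
  have h0' := (mul_eq_zero.mp h0).resolve_left hne
  have h1' := (mul_eq_zero.mp h1).resolve_left hne
  have hv2 : v 0 ≠ 0 ∨ v 1 ≠ 0 := by
    by_contra hcon; push Not at hcon
    exact hv0 (by ext i; fin_cases i; exacts [hcon.1, hcon.2])
  have hw2 : w 0 ≠ 0 ∨ w 1 ≠ 0 := by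
    by_contra hcon; push Not at hcon
    exact hw0 (by ext i; fin_cases i; exacts [hcon.1, hcon.2])
  rcases mul_eq_zero.mp h0' with h2 | h2 <;> rcases mul_eq_zero.mp h1' with h3 | h3
  · exact hv2.elim (· h2) (· h3)
  · rw [h2, h3] at h
    rcases mul_eq_zero.mp (show v 1 * w 0 = 0 by linarith) with h4 | h4
    exacts [hv2.elim (· h2) (· h4), hw2.elim (· h4) (· h3)]
  · rw [h2, h3] at h
    rcases mul_eq_zero.mp (show v 0 * w 1 = 0 by linarith) with h4 | h4
    exacts [hv2.elim (· h4) (· h3), hw2.elim (· h2) (· h4)]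
  · exact hw2.elim (· h2) (· h3)

/-- If `τ⁻¹ β τ` is bounded up to scalars, then so are the products of the coordinates of the
columns of `τ` with respect to two left eigenvectors `v`, `w` of `β`. -/
lemma abs_coord_mul_le {β τ : SL(2, ℝ)} {l m R : ℝ} (hne : l - m ≠ 0) {v w : Fin 2 → ℝ}
    (hv : Matrix.vecMul v β.1 = l • v) (hw : Matrix.vecMul w β.1 = m • w)
    (h01 : |(τ⁻¹ * β * τ).1 0 1| ≤ R) (h10 : |(τ⁻¹ * β * τ).1 1 0| ≤ R)
    (hdiff : |(τ⁻¹ * β * τ).1 0 0 - (τ⁻¹ * β * τ).1 1 1| ≤ R) (i j : Fin 2) :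
    |Matrix.vecMul v τ.1 i * Matrix.vecMul w τ.1 j| ≤
      |v 0 * w 1 - v 1 * w 0| * R / |l - m| + |v 0 * w 1 - v 1 * w 0| := by
  have ev0 := congrFun hv 0
  have ev1 := congrFun hv 1
  have ew0 := congrFun hw 0
  have ew1 := congrFun hw 1
  rw [vecMul_fin_two, Pi.smul_apply, smul_eq_mul] at ev0 ev1 ew0 ew1
  have hdetτ := det_entries τ
  have e01 : (τ⁻¹ * β * τ).1 0 1 = _ := congrFun (congrFun (conj_entries τ β) 0) 1
  have e10 : (τ⁻¹ * β * τ).1 1 0 = _ := congrFun (congrFun (conj_entries τ β) 1) 0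
  have e00 : (τ⁻¹ * β * τ).1 0 0 = _ := congrFun (congrFun (conj_entries τ β) 0) 0
  have e11 : (τ⁻¹ * β * τ).1 1 1 = _ := congrFun (congrFun (conj_entries τ β) 1) 1
  simp only [Matrix.of_apply, Matrix.cons_val] at e01 e10 e00 e11
  set X := (τ⁻¹ * β * τ).1
  set D := v 0 * w 1 - v 1 * w 0 with hD
  set x : Fin 2 → ℝ := Matrix.vecMul v τ.1 with hx
  set y : Fin 2 → ℝ := Matrix.vecMul w τ.1 with hy
  have hxj : ∀ j, x j = v 0 * τ.1 0 j + v 1 * τ.1 1 j := fun j => vecMul_fin_two _ _ _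
  have hyj : ∀ j, y j = w 0 * τ.1 0 j + w 1 * τ.1 1 j := fun j => vecMul_fin_two _ _ _
  have hxy : x 0 * y 1 - x 1 * y 0 = D := by
    rw [hxj, hxj, hyj, hyj, hD]; linear_combination (v 0 * w 1 - v 1 * w 0) * hdetτ
  have bound : ∀ z X : ℝ, |X| ≤ R → (l - m) * z = D * X → |z| ≤ |D| * R / |l - m| := by
    intro z X hX h
    rw [le_div_iff₀ (abs_pos.mpr hne), mul_comm, ← abs_mul, h, abs_mul]
    gcongr
  have hl' : ∀ j, l * x j = v 0 * (β.1 0 0 * τ.1 0 j + β.1 0 1 * τ.1 1 j) +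
      v 1 * (β.1 1 0 * τ.1 0 j + β.1 1 1 * τ.1 1 j) := fun j => by
    rw [hxj]; linear_combination (-τ.1 0 j) * ev0 - τ.1 1 j * ev1
  have hm' : ∀ j, m * y j = w 0 * (β.1 0 0 * τ.1 0 j + β.1 0 1 * τ.1 1 j) +
      w 1 * (β.1 1 0 * τ.1 0 j + β.1 1 1 * τ.1 1 j) := fun j => by
    rw [hyj]; linear_combination (-τ.1 0 j) * ew0 - τ.1 1 j * ew1
  have b11 : |x 1 * y 1| ≤ |D| * R / |l - m| := bound _ _ h01 (by
    rw [show (l - m) * (x 1 * y 1) = (l * x 1) * y 1 - x 1 * (m * y 1) by ring, hl', hm', hxj, hyj,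
      hD, e01]
    ring)
  have b00 : |x 0 * y 0| ≤ |D| * R / |l - m| := bound _ (-X 1 0) (by rwa [abs_neg]) (by
    rw [show (l - m) * (x 0 * y 0) = (l * x 0) * y 0 - x 0 * (m * y 0) by ring, hl', hm', hxj, hyj,
      hD, e10]
    ring)
  have bs : |x 0 * y 1 + x 1 * y 0| ≤ |D| * R / |l - m| := bound _ _ hdiff (by
    rw [show (l - m) * (x 0 * y 1 + x 1 * y 0) = (l * x 0) * y 1 + (l * x 1) * y 0 -
      x 0 * (m * y 1) - x 1 * (m * y 0) by ring, hl', hl', hm', hm', hxj, hxj, hyj, hyj, hD,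
      e00, e11]
    ring)
  have h1 := abs_le.mp bs
  have h2 := le_abs_self D
  have h3 := neg_abs_le D
  have h4 : 0 ≤ |D| * R / |l - m| := (abs_nonneg _).trans bs
  fin_cases i <;> fin_cases j
  · exact b00.trans (by linarith)
  · change |x 0 * y 1| ≤ _
    rw [abs_le]; constructor <;> linarith
  · change |x 1 * y 0| ≤ _
    rw [abs_le]; constructor <;> linarith
  · exact b11.trans (by linarith)

/-- Around a hyperbolic element `β` the thin frames are bounded modulo the powers of `β`: in
coordinates given by left eigenvectors, `β` scales the two rows of a frame by inverse factors, and
the products of their entries are bounded. -/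
lemma exists_entries_le_of_hyperbolic {β : SL(2, ℝ)} (ht : 4 < (β.1 0 0 + β.1 1 1) ^ 2) (R : ℝ) :
    ∃ R', ∀ τ : SL(2, ℝ), |(τ⁻¹ * β * τ).1 0 1| ≤ R → |(τ⁻¹ * β * τ).1 1 0| ≤ R →
      |(τ⁻¹ * β * τ).1 0 0 - (τ⁻¹ * β * τ).1 1 1| ≤ R →
      ∃ n : ℤ, ∀ i j, |(β ^ n * τ).1 i j| ≤ R' := by
  obtain ⟨l, hl1, hl⟩ := exists_root_of_hyperbolic ht
  have hl0 : l ≠ 0 := fun h => by rw [h] at hl; simp at hl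
  set m := l⁻¹ with hm
  have hlm : l * m = 1 := mul_inv_cancel₀ hl0
  have hm0 : m ≠ 0 := inv_ne_zero hl0
  have hroot : m ^ 2 - (β.1 0 0 + β.1 1 1) * m + 1 = 0 := by
    have : l ^ 2 * (m ^ 2 - (β.1 0 0 + β.1 1 1) * m + 1) = 0 := by
      linear_combination hl + (l * m + 1 - (β.1 0 0 + β.1 1 1) * l) * hlm
    exact (mul_eq_zero.mp this).resolve_left (pow_ne_zero 2 hl0)
  have hne : l - m ≠ 0 := fun h => by
    have h1 : l = m := sub_eq_zero.mp h
    rw [← h1] at hlm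
    have h2 := sq_abs l
    nlinarith
  obtain ⟨v, hv0, hv⟩ := exists_left_eigenvector hl
  obtain ⟨w, hw0, hw⟩ := exists_left_eigenvector hroot
  set D := v 0 * w 1 - v 1 * w 0 with hD
  have hD0 : D ≠ 0 := det_ne_zero_of_left_eigenvectors hne hv0 hw0 hv hw
  set C := |D| * R / |l - m| + |D| with hC
  set R' := ((|v 0| + |v 1|) * C + (|w 0| + |w 1|) * |l|) / |D| with hR'
  refine ⟨R', fun τ h01 h10 hdiff => ?_⟩
  have hdetτ := det_entries τ
  set x : Fin 2 → ℝ := Matrix.vecMul v τ.1 with hx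
  set y : Fin 2 → ℝ := Matrix.vecMul w τ.1 with hy
  have hxj : ∀ j, x j = v 0 * τ.1 0 j + v 1 * τ.1 1 j := fun j => vecMul_fin_two _ _ _
  have hyj : ∀ j, y j = w 0 * τ.1 0 j + w 1 * τ.1 1 j := fun j => vecMul_fin_two _ _ _
  have hxy : x 0 * y 1 - x 1 * y 0 = D := by
    rw [hxj, hxj, hyj, hyj, hD]; linear_combination (v 0 * w 1 - v 1 * w 0) * hdetτ
  have hDabs : 0 < |D| := abs_pos.mpr hD0
  have hall : ∀ i j, |x i * y j| ≤ C := abs_coord_mul_le hne hv hw h01 h10 hdiff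
  obtain ⟨i₀, hi₀⟩ : ∃ i, ∀ j, |x j| ≤ |x i| := by
    obtain ⟨i, hi⟩ := Finite.exists_max (fun i => |x i|)
    exact ⟨i, hi⟩
  have hxpos : 0 < |x i₀| := by
    by_contra hcon
    have hz : ∀ j, x j = 0 := fun j =>
      abs_eq_zero.mp (le_antisymm ((hi₀ j).trans (not_lt.mp hcon)) (abs_nonneg _))
    rw [hz, hz] at hxy
    exact hD0 (by linarith)
  -- the power of `β` is chosen to bring the larger entry of the row `x` into `[1, |l|)`
  obtain ⟨n, hn⟩ := exists_mem_Ico_zpow hxpos hl1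
  refine ⟨-n, ?_⟩
  have hx' : Matrix.vecMul v (β ^ (-n) * τ : SL(2, ℝ)).1 = l ^ (-n) • x := by
    rw [coe_mul, ← Matrix.vecMul_vecMul, vecMul_zpow hl0 hv, Matrix.smul_vecMul]
  have hy' : Matrix.vecMul w (β ^ (-n) * τ : SL(2, ℝ)).1 = m ^ (-n) • y := by
    rw [coe_mul, ← Matrix.vecMul_vecMul, vecMul_zpow hm0 hw, Matrix.smul_vecMul]
  set τ' := β ^ (-n) * τ with hτ'
  have hxj' : ∀ j, v 0 * τ'.1 0 j + v 1 * τ'.1 1 j = l ^ (-n) * x j := fun j => by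
    rw [← vecMul_fin_two, hx']; rfl
  have hyj' : ∀ j, w 0 * τ'.1 0 j + w 1 * τ'.1 1 j = m ^ (-n) * y j := fun j => by
    rw [← vecMul_fin_two, hy']; rfl
  have hln : 0 < |l| ^ n := zpow_pos (by linarith) n
  have hbx : ∀ j, |l ^ (-n) * x j| ≤ |l| := fun j => by
    rw [abs_mul, abs_zpow, zpow_neg, inv_mul_le_iff₀ hln]
    have h1 := hn.2
    rw [zpow_add_one₀ (by linarith)] at h1
    exact (hi₀ j).trans h1.le
  have hbx1 : 1 ≤ |l ^ (-n) * x i₀| := by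
    rw [abs_mul, abs_zpow, zpow_neg, le_inv_mul_iff₀ hln, mul_one]
    exact hn.1
  have hby : ∀ j, |m ^ (-n) * y j| ≤ C := fun j => by
    have h1 : |l ^ (-n) * x i₀| * |m ^ (-n) * y j| ≤ C := by
      rw [← abs_mul, show l ^ (-n) * x i₀ * (m ^ (-n) * y j) = (l * m) ^ (-n) * (x i₀ * y j) by
        rw [mul_zpow]; ring, hlm, one_zpow, one_mul]
      exact hall i₀ j
    nlinarith [abs_nonneg (m ^ (-n) * y j)]
  have hCn : 0 ≤ C := (abs_nonneg _).trans (hall 0 0)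
  intro i j
  rw [hR', le_div_iff₀ hDabs, ← abs_mul]
  have h1 := hbx j
  have h2 := hby j
  have tri : ∀ a b p q : ℝ, |a * p - b * q| ≤ |a| * |p| + |b| * |q| := fun a b p q => by
    rw [← abs_mul, ← abs_mul]; exact abs_sub _ _
  have hA := abs_nonneg (v 0)
  have hB := abs_nonneg (v 1)
  have hE := abs_nonneg (w 0)
  have hF := abs_nonneg (w 1)
  have hl3 : 0 ≤ |l| := abs_nonneg l
  have hAC := mul_nonneg hA hCn
  have hBC := mul_nonneg hB hCn
  have hEl := mul_nonneg hE hl3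
  have hFl := mul_nonneg hF hl3
  fin_cases i
  · change |τ'.1 0 j * D| ≤ _
    have : τ'.1 0 j * D = w 1 * (l ^ (-n) * x j) - v 1 * (m ^ (-n) * y j) := by
      rw [← hxj', ← hyj', hD]; ring
    rw [this]
    refine (tri _ _ _ _).trans ?_
    have := mul_le_mul_of_nonneg_left h1 hF
    have := mul_le_mul_of_nonneg_left h2 hB
    linarith
  · change |τ'.1 1 j * D| ≤ _
    have : τ'.1 1 j * D = v 0 * (m ^ (-n) * y j) - w 0 * (l ^ (-n) * x j) := by
      rw [← hxj', ← hyj', hD]; ring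
    rw [this]
    refine (tri _ _ _ _).trans ?_
    have := mul_le_mul_of_nonneg_left h1 hE
    have := mul_le_mul_of_nonneg_left h2 hA
    linarith

/-! ### The lower bound for the height -/

lemma im_smul_I (ρ : SL(2, ℝ)) : (ρ • I).im = 1 / (ρ.1 1 0 ^ 2 + ρ.1 1 1 ^ 2) := by
  have h := im_smul_eq_div_normSq (mapGL ℝ ρ) I
  rw [MulAction.compHom_smul_def, h]
  simp [denom, Complex.normSq_apply]
  ring

/-- If `ρ⁻¹ Y ρ` is close to the identity for a nontrivial integral translation `Y`, up to sign,
then `ρ • i` is high up in the upper half-plane. -/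
lemma le_im_of_translation {ρ Y : SL(2, ℝ)} {m : ℤ} (hm : m ≠ 0)
    (hY : Y.1 = !![1, (m : ℝ); 0, 1] ∨ Y.1 = -!![1, (m : ℝ); 0, 1])
    (h01 : |(ρ⁻¹ * Y * ρ).1 0 1| ≤ 1 / 30) (h10 : |(ρ⁻¹ * Y * ρ).1 1 0| ≤ 1 / 30) :
    15 ≤ (ρ • I).im := by
  have hdet := det_entries ρ
  have e01 : (ρ⁻¹ * Y * ρ).1 0 1 = _ := congrFun (congrFun (conj_entries ρ Y) 0) 1
  have e10 : (ρ⁻¹ * Y * ρ).1 1 0 = _ := congrFun (congrFun (conj_entries ρ Y) 1) 0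
  simp only [Matrix.of_apply, Matrix.cons_val] at e01 e10
  have h1 : |(ρ⁻¹ * Y * ρ).1 0 1| = |(m : ℝ)| * ρ.1 1 1 ^ 2 := by
    rw [e01]
    rcases hY with h | h <;> rw [h] <;> simp
    · rw [← abs_sq (ρ.1 1 1), ← abs_mul]; ring_nf
    · rw [← abs_sq (ρ.1 1 1), ← abs_mul, ← abs_neg]; ring_nf
  have h2 : |(ρ⁻¹ * Y * ρ).1 1 0| = |(m : ℝ)| * ρ.1 1 0 ^ 2 := by
    rw [e10]
    rcases hY with h | h <;> rw [h] <;> simp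
    · rw [← abs_sq (ρ.1 1 0), ← abs_mul, ← abs_neg]; ring_nf
    · rw [← abs_sq (ρ.1 1 0), ← abs_mul]; ring_nf
  have hm1 : (1 : ℝ) ≤ |(m : ℝ)| := by exact_mod_cast Int.one_le_abs hm
  have h3 : ρ.1 1 0 ^ 2 + ρ.1 1 1 ^ 2 ≤ 1 / 15 := by
    nlinarith [sq_nonneg (ρ.1 1 0), sq_nonneg (ρ.1 1 1)]
  have h4 : 0 < ρ.1 1 0 ^ 2 + ρ.1 1 1 ^ 2 := by
    by_contra hcon
    have h5 : ρ.1 1 0 = 0 := by nlinarith [sq_nonneg (ρ.1 1 0), sq_nonneg (ρ.1 1 1)]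
    have h6 : ρ.1 1 1 = 0 := by nlinarith [sq_nonneg (ρ.1 1 0), sq_nonneg (ρ.1 1 1)]
    rw [h5, h6] at hdet
    norm_num at hdet
  rw [im_smul_I, le_div_iff₀ h4]
  linarith

lemma isParabolic_mapGL {γ : SL(2, ℝ)} (h1 : γ ≠ 1) (h2 : γ ≠ -1)
    (ht : (γ.1 0 0 + γ.1 1 1) ^ 2 = 4) : (mapGL ℝ γ).IsParabolic := by
  have hcoe : (mapGL ℝ γ).val = γ.1 := by ext i j; simp
  refine ⟨?_, ?_⟩
  · rintro ⟨x, hx⟩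
    rw [hcoe] at hx
    rcases eq_one_or_neg_one_of_entries (g := γ) (by rw [← hx]; simp) (by rw [← hx]; simp)
      (by rw [← hx]; simp) with h | h
    exacts [h1 h, h2 h]
  · rw [hcoe, Matrix.discr_fin_two, Matrix.trace_fin_two, γ.2, ht]; norm_num

/-- Where a parabolic element is short, the point lies high in the neighbourhood of a cusp. -/
lemma exists_le_im_of_parabolic {Γ : Subgroup SL(2, ℝ)} {ι : Type*} (S : CuspSystem Γ ι)
    {τ γ : SL(2, ℝ)} (hγ : γ ∈ Γ) (h1 : γ ≠ 1) (h2 : γ ≠ -1)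
    (ht : (γ.1 0 0 + γ.1 1 1) ^ 2 = 4) (hd : disp τ γ < 1 / 30) :
    ∃ a, ∃ δ ∈ Γ, 15 ≤ (((S.σ a)⁻¹ * δ) • τ • I).im := by
  have hpar := isParabolic_mapGL h1 h2 ht
  set c : OnePoint ℝ := (mapGL ℝ γ).parabolicFixedPoint
  have hfix : mapGL ℝ γ • c = c := hpar.smul_eq_self_iff.mpr rfl
  have hcusp : IsCusp c (Γ.map (mapGL ℝ)) := ⟨_, Subgroup.mem_map_of_mem _ hγ, hpar, hfix⟩
  obtain ⟨a, ⟨δ, hδ, hδc⟩, -⟩ := S.complete c hcusp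
  have hγ' : δ⁻¹ * γ * δ ∈ Γ := Γ.mul_mem (Γ.mul_mem (Γ.inv_mem hδ) hγ) hδ
  have hfix' : mapGL ℝ (δ⁻¹ * γ * δ) • S.cusp a = S.cusp a := by
    rw [map_mul, map_mul, mul_smul, mul_smul, hδc, hfix, map_inv, inv_smul_eq_iff, hδc]
  obtain ⟨m, hm⟩ := (S.scaling a (δ⁻¹ * γ * δ)).mp ⟨Or.inl hγ', hfix'⟩
  set Y := (S.σ a)⁻¹ * (δ⁻¹ * γ * δ) * S.σ a with hY
  set ρ := (S.σ a)⁻¹ * δ⁻¹ * τ with hρ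
  have hconj : ρ⁻¹ * Y * ρ = τ⁻¹ * γ * τ := by rw [hρ, hY]; group
  have hγY : γ = (δ * S.σ a) * Y * (δ * S.σ a)⁻¹ := by rw [hY]; group
  have hm0 : m ≠ 0 := by
    rintro rfl
    rcases hm with h | h
    · have : Y = 1 := Subtype.ext (by rw [h, coe_one, Matrix.one_fin_two]; simp)
      exact h1 (by rw [hγY, this]; group)
    · have : Y = -1 := Subtype.ext (by rw [h, coe_neg, coe_one, Matrix.one_fin_two]; simp)
      exact h2 (by rw [hγY, this]; simp)
  refine ⟨a, δ⁻¹, Γ.inv_mem hδ, ?_⟩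
  rw [← mul_smul, ← hρ]
  have hle := fun i j => (abs_entry_le_norm ((τ⁻¹ * γ * τ : SL(2, ℝ)).1 - 1) i j).trans hd.le
  refine le_im_of_translation hm0 hm ?_ ?_
  · rw [hconj]; simpa using hle 0 1
  · rw [hconj]; simpa using hle 1 0

lemma sq_trace_eq_four_of_commute {β γ : SL(2, ℝ)} (h1 : β ≠ 1) (h2 : β ≠ -1)
    (hc : β * γ = γ * β) (ht : (β.1 0 0 + β.1 1 1) ^ 2 = 4) :
    (γ.1 0 0 + γ.1 1 1) ^ 2 = 4 := by
  obtain ⟨p, q, h⟩ := exists_eq_add_smul_of_commute h1 h2 hc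
  have hγ := det_entries γ
  have hβ := det_entries β
  rw [h] at hγ ⊢
  simp at hγ ⊢
  linear_combination 4 * hγ + q ^ 2 * ht - 4 * q ^ 2 * hβ

/-- The thick-thin decomposition: modulo a discrete group of finite covolume, every frame is
bounded or lies over a point high in the neighbourhood of a cusp. -/
lemma exists_entries_le_or_le_im (Γ : Subgroup SL(2, ℝ)) [DiscreteTopology Γ] {D : Set ℍ}
    (hD : IsFundDomain Γ D) (hvol : volume D < ⊤) {ι : Type*} (S : CuspSystem Γ ι) :
    ∃ R : ℝ, ∀ τ : SL(2, ℝ), (∃ δ ∈ Γ, ∀ i j, |(δ * τ).1 i j| ≤ R) ∨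
      ∃ a, ∃ δ ∈ Γ, 15 ≤ (((S.σ a)⁻¹ * δ) • τ • I).im := by
  obtain ⟨R₁, hR₁⟩ := exists_entries_le_of_thick Γ hD hvol
  -- elements of displacement less than `1 / 10` in a frame with entries at most `R₁` have entries
  -- at most `R₂`, so the short elements `β` below come from a finite set modulo conjugation
  set R₂ := (2 * R₁) ^ 2 * (1 / 10 + 3 / 2)
  have hfin := finite_of_entries_le Γ R₂
  have hH : ∀ β : SL(2, ℝ), ∃ R, β ∈ Γ → β ≠ 1 → β ≠ -1 → (β.1 0 0 + β.1 1 1) ^ 2 ≠ 4 →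
      ∀ τ, ∀ γ ∈ Γ, γ ≠ 1 → β * γ = γ * β → disp τ γ < 1 / 30 →
        ∃ δ ∈ Γ, ∀ i j, |(δ * τ).1 i j| ≤ R := by
    intro β
    by_cases hβ1 : β = 1
    · exact ⟨0, fun _ h => absurd hβ1 h⟩
    by_cases hβ2 : β = -1
    · exact ⟨0, fun _ _ h => absurd hβ2 h⟩
    obtain ⟨R, hR⟩ := exists_conj_le Γ hβ1 hβ2
    rcases lt_trichotomy ((β.1 0 0 + β.1 1 1) ^ 2) 4 with h | h | h
    · obtain ⟨R', hR'⟩ := exists_entries_le_of_elliptic h R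
      refine ⟨R', fun _ _ _ _ τ γ hγ hγ1 hc hd => ⟨1, Γ.one_mem, ?_⟩⟩
      obtain ⟨h01, h10, -⟩ := hR τ γ hγ hγ1 hc hd
      rw [one_mul]
      exact hR' τ h01 h10
    · exact ⟨0, fun _ _ _ h' => absurd h h'⟩
    · obtain ⟨R', hR'⟩ := exists_entries_le_of_hyperbolic h R
      refine ⟨R', fun hβ _ _ _ τ γ hγ hγ1 hc hd => ?_⟩
      obtain ⟨h01, h10, h00⟩ := hR τ γ hγ hγ1 hc hd
      obtain ⟨n, hn⟩ := hR' τ h01 h10 h00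
      exact ⟨β ^ n, Γ.zpow_mem hβ n, hn⟩
  choose RH hRH using hH
  refine ⟨|R₁| + ∑ β ∈ hfin.toFinset, |RH β|, fun τ => ?_⟩
  have hsum : 0 ≤ ∑ β ∈ hfin.toFinset, |RH β| := Finset.sum_nonneg fun _ _ => abs_nonneg _
  by_cases hthick : IsThick Γ τ
  · left
    obtain ⟨δ, hδ, h⟩ := hR₁ τ hthick
    exact ⟨δ, hδ, fun i j => (h i j).trans (by linarith [le_abs_self R₁])⟩
  simp only [IsThick, not_forall, not_le] at hthick
  obtain ⟨γ, hγ, hγ1, hd⟩ := hthick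
  have hγ2 : γ ≠ -1 := ne_neg_one_of_disp_lt (hd.trans (by norm_num))
  obtain ⟨τ', β, hτ', hβ, hβ1, hc, hdβ⟩ := exists_thick_of_thin Γ hγ hγ1 hd
  have hβ2 : β ≠ -1 := ne_neg_one_of_disp_lt hdβ
  by_cases hpar : (β.1 0 0 + β.1 1 1) ^ 2 = 4
  · right
    exact exists_le_im_of_parabolic S hγ hγ1 hγ2
      (sq_trace_eq_four_of_commute hβ1 hβ2 hc.symm hpar) hd
  left
  obtain ⟨δ, hδ, hδτ⟩ := hR₁ τ' hτ'
  set β' := δ * β * δ⁻¹ with hβ'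
  set γ' := δ * γ * δ⁻¹ with hγ'
  have hconj : ∀ x : SL(2, ℝ), x = δ⁻¹ * (δ * x * δ⁻¹) * δ := fun x => by group
  have hβ'Γ : β' ∈ Γ := Γ.mul_mem (Γ.mul_mem hδ hβ) (Γ.inv_mem hδ)
  have hγ'Γ : γ' ∈ Γ := Γ.mul_mem (Γ.mul_mem hδ hγ) (Γ.inv_mem hδ)
  have hβ'1 : β' ≠ 1 := fun h => hβ1 (by rw [hconj β, ← hβ', h]; group)
  have hβ'2 : β' ≠ -1 := fun h => hβ2 (by rw [hconj β, ← hβ', h]; simp)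
  have hγ'1 : γ' ≠ 1 := fun h => hγ1 (by rw [hconj γ, ← hγ', h]; group)
  have hcomm : β' * γ' = γ' * β' := by
    have e1 : β' * γ' = δ * (β * γ) * δ⁻¹ := by rw [hβ', hγ']; group
    have e2 : γ' * β' = δ * (γ * β) * δ⁻¹ := by rw [hβ', hγ']; group
    rw [e1, e2, hc]
  have htr : (β'.1 0 0 + β'.1 1 1) ^ 2 ≠ 4 := by
    have : β'.1 0 0 + β'.1 1 1 = β.1 0 0 + β.1 1 1 := by
      rw [← Matrix.trace_fin_two, ← Matrix.trace_fin_two, hβ', coe_mul, coe_mul, mul_assoc,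
        Matrix.trace_mul_comm, mul_assoc, ← coe_mul δ⁻¹ δ, inv_mul_cancel, coe_one, mul_one]
    rwa [this]
  have hβ'fin : β' ∈ hfin.toFinset := by
    rw [Set.Finite.mem_toFinset]
    refine ⟨hβ'Γ, fun i j => ?_⟩
    have h1 : disp (δ * τ') β' ≤ 1 / 10 := by rw [hβ', disp_mul_left]; exact hdβ.le
    refine (entries_le_of_disp_le h1 i j).trans ?_
    have h2 := pow_le_pow_left₀ (norm_nonneg _) (norm_le_of_entries hδτ) 2
    exact mul_le_mul_of_nonneg_right h2 (by norm_num)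
  obtain ⟨δ', hδ', h⟩ := hRH β' hβ'Γ hβ'1 hβ'2 htr (δ * τ) γ' hγ'Γ hγ'1 hcomm
    (by rw [hγ', disp_mul_left]; exact hd)
  refine ⟨δ' * δ, Γ.mul_mem hδ' hδ, fun i j => ?_⟩
  rw [mul_assoc]
  have h3 : |RH β'| ≤ ∑ β ∈ hfin.toFinset, |RH β| :=
    Finset.single_le_sum (f := fun β => |RH β|) (fun _ _ => abs_nonneg _) hβ'fin
  exact (h i j).trans (by linarith [le_abs_self (RH β'), abs_nonneg R₁])

lemma exists_le_disp (Γ : Subgroup SL(2, ℝ)) [DiscreteTopology Γ] (τ : SL(2, ℝ)) :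
    ∃ c > 0, ∀ γ ∈ Γ, γ ≠ 1 → c ≤ disp τ γ := by
  set T : Set SL(2, ℝ) := {γ | γ ∈ Γ ∧ γ ≠ 1 ∧ disp τ γ ≤ 1} with hT
  have hfin : T.Finite :=
    (finite_of_entries_le Γ _).subset fun γ hγ => ⟨hγ.1, entries_le_of_disp_le hγ.2.2⟩
  by_cases hne : T.Nonempty
  · obtain ⟨g, hg, hmin⟩ := hfin.exists_minimalFor (disp τ) T hne
    refine ⟨min 1 (disp τ g), lt_min one_pos (disp_pos hg.2.1), fun γ hγ hγ1 => ?_⟩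
    by_contra hlt
    rw [not_le, lt_min_iff] at hlt
    exact absurd (hmin ⟨hγ, hγ1, hlt.1.le⟩ hlt.2.le) (not_le.mpr hlt.2)
  · exact ⟨1, one_pos, fun γ hγ hγ1 => (not_le.mp fun h => hne ⟨γ, hγ, hγ1, h⟩).le⟩

/-- The supremum defining the height is over a bounded set: a point very high above a cusp is
moved very little by a parabolic element of `Γ`. -/
lemma CuspSystem.bddAbove_im {Γ : Subgroup SL(2, ℝ)} [DiscreteTopology Γ] {ι : Type*}
    (S : CuspSystem Γ ι) (z : ℍ) :
    BddAbove (Set.range fun p : ι × Γ => (((S.σ p.1)⁻¹ * (p.2 : SL(2, ℝ))) • z).im) := by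
  set τ := z.toSL2R with hτ
  have hz : z = τ • I := (toSL2R_smul_I z).symm
  obtain ⟨c, hc, hdisp⟩ := exists_le_disp Γ τ
  refine ⟨2 / c, ?_⟩
  rintro _ ⟨⟨a, δ, hδ⟩, rfl⟩
  change (((S.σ a)⁻¹ * δ) • z).im ≤ 2 / c
  rw [hz, ← mul_smul]
  set ρ := (S.σ a)⁻¹ * δ * τ with hρ
  set g := S.σ a * upperUnip 1 * (S.σ a)⁻¹ with hg
  have hgm := ((S.scaling a g).mpr ⟨1, Or.inl (by
    have : (S.σ a)⁻¹ * g * S.σ a = upperUnip 1 := by rw [hg]; group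
    rw [this, coe_upperUnip]; simp)⟩).1
  -- the square of `g` lies in `Γ` also when only `-g` does
  have hgg : g * g ∈ Γ := by
    rcases hgm with h | h
    · exact Γ.mul_mem h h
    · rw [← neg_mul_neg]; exact Γ.mul_mem h h
  set α := δ⁻¹ * (g * g) * δ with hα
  have hαΓ : α ∈ Γ := Γ.mul_mem (Γ.mul_mem (Γ.inv_mem hδ) hgg) hδ
  have hUU : upperUnip 1 * upperUnip 1 = upperUnip 2 := by
    apply Subtype.ext
    rw [coe_mul, coe_upperUnip, coe_upperUnip]; simp; norm_num
  have hconj : τ⁻¹ * α * τ = ρ⁻¹ * upperUnip 2 * ρ := by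
    rw [← hUU, hα, hρ, hg]; group
  have hα1 : α ≠ 1 := by
    intro h
    rw [h] at hconj
    have h2 : upperUnip 2 = 1 := by
      calc upperUnip 2 = ρ * (ρ⁻¹ * upperUnip 2 * ρ) * ρ⁻¹ := by group
        _ = 1 := by rw [← hconj]; group
    have h3 : (upperUnip 2).1 0 1 = (1 : SL(2, ℝ)).1 0 1 := by rw [h2]
    rw [coe_upperUnip] at h3
    simp at h3
  have hle := hdisp α hαΓ hα1
  have hdet := det_entries ρ
  have hpos : 0 < ρ.1 1 0 ^ 2 + ρ.1 1 1 ^ 2 := by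
    have := (ρ • I).im_pos
    rw [im_smul_I] at this
    exact one_div_pos.mp this
  have hval : disp τ α = 2 * (ρ.1 1 0 ^ 2 + ρ.1 1 1 ^ 2) := by
    rw [disp, hconj, ← sq_eq_sq₀ (norm_nonneg _) (by positivity), frobenius_sq, conj_entries,
      coe_upperUnip]
    simp
    grind
  rw [im_smul_I, div_le_div_iff₀ hpos hc]
  linarith

/-- A group of finite covolume with non-compact quotient has a cusp, and the height function is
bounded below by a positive constant. -/
lemma CuspSystem.exists_le_height {Γ : Subgroup SL(2, ℝ)} [DiscreteTopology Γ] {D : Set ℍ}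
    (hD : IsFundDomain Γ D) (hvol : volume D < ⊤)
    (hnoncompact : NoncompactSpace (MulAction.orbitRel.Quotient Γ ℍ)) {ι : Type*}
    (S : CuspSystem Γ ι) : ∃ c > 0, ∀ z, c ≤ S.height z := by
  obtain ⟨R, hR⟩ := exists_entries_le_or_le_im Γ hD hvol S
  set K : Set ℍ := (fun g : SL(2, ℝ) => g • I) '' {g | ∀ i j, |g.1 i j| ≤ R} with hKdef
  have hK : IsCompact K := (isCompact_entries_le R).image (by fun_prop)
  have hcases : ∀ z : ℍ, (∃ δ ∈ Γ, δ • z ∈ K) ∨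
      ∃ a, ∃ δ ∈ Γ, 15 ≤ (((S.σ a)⁻¹ * δ) • z).im := fun z => by
    have hz : z = z.toSL2R • I := (toSL2R_smul_I z).symm
    rcases hR z.toSL2R with ⟨δ, hδ, h⟩ | h
    · left
      refine ⟨δ, hδ, δ * z.toSL2R, h, ?_⟩
      change (δ * z.toSL2R) • I = _
      rw [mul_smul, ← hz]
    · right; rwa [← hz] at h
  have hι : Nonempty ι := by
    by_contra hempty
    rw [not_nonempty_iff] at hempty
    refine hnoncompact.noncompact_univ ?_
    convert! hK.image (f := (Quotient.mk'' : ℍ → MulAction.orbitRel.Quotient Γ ℍ))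
      continuous_quot_mk
    refine (Set.eq_univ_of_forall fun x => ?_).symm
    induction x using Quotient.inductionOn' with
    | h z =>
      obtain ⟨δ, hδ, h⟩ := (hcases z).resolve_right fun ⟨a, _⟩ => hempty.elim a
      exact ⟨δ • z, h, Quotient.sound' ⟨⟨δ, hδ⟩, rfl⟩⟩
  obtain ⟨a₀⟩ := hι
  obtain ⟨c, hc, hcK⟩ : ∃ c > 0, ∀ w ∈ K, c ≤ ((S.σ a₀)⁻¹ • w).im := by
    rcases K.eq_empty_or_nonempty with h | h
    · exact ⟨1, one_pos, by simp [h]⟩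
    · obtain ⟨w, hw, hmin⟩ := hK.exists_isMinOn h
        (f := fun w => ((S.σ a₀)⁻¹ • w).im) (by fun_prop)
      exact ⟨_, im_pos _, fun w' hw' => hmin hw'⟩
  refine ⟨min c 15, lt_min hc (by norm_num), fun z => ?_⟩
  rcases hcases z with ⟨δ, hδ, h⟩ | ⟨a, δ, hδ, h⟩
  · refine (min_le_left _ _).trans ((hcK _ h).trans ?_)
    rw [← mul_smul]
    exact le_ciSup (S.bddAbove_im z) (a₀, ⟨δ, hδ⟩)
  · exact (min_le_right _ _).trans (h.trans (le_ciSup (S.bddAbove_im z) (a, ⟨δ, hδ⟩)))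

end ThinFrames

open ComplexConjugate

/-! ### A point-pair invariant and its derivative -/

lemma autJ_ne_zero (g : SL(2, ℝ)) (z : ℍ) : autJ g z ≠ 0 := by
  have h := denom_ne_zero (mapGL ℝ g) z
  simpa [denom, autJ] using h

lemma coe_smul_eq (g : SL(2, ℝ)) (z : ℍ) :
    ((g • z : ℍ) : ℂ) = ((g.1 0 0 : ℂ) * z + g.1 0 1) / autJ g z := by
  rw [coe_specialLinearGroup_apply]; rfl

lemma im_smul_eq (g : SL(2, ℝ)) (z : ℍ) :
    ((g • z).im : ℂ) = z.im / (autJ g z * conj (autJ g z)) := by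
  have h := im_smul_eq_div_normSq (mapGL ℝ g) z
  rw [MulAction.compHom_smul_def, h, Complex.mul_conj]
  push_cast
  simp [denom, autJ]

lemma autEps_sq (g : SL(2, ℝ)) (z : ℍ) :
    autEps g z ^ 2 = autJ g z / conj (autJ g z) := by
  have h := autJ_ne_zero g z
  have h' : conj (autJ g z) ≠ 0 := (map_ne_zero _).mpr h
  rw [autEps, div_pow, ← Complex.ofReal_pow, ← Complex.normSq_eq_norm_sq, ← Complex.mul_conj]
  field_simp

lemma norm_autEps (g : SL(2, ℝ)) (z : ℍ) : ‖autEps g z‖ = 1 := by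
  have h := norm_ne_zero_iff.mpr (autJ_ne_zero g z)
  rw [autEps, norm_div, Complex.norm_real, norm_norm, div_self h]

lemma det_entries_complex (g : SL(2, ℝ)) :
    (g.1 0 0 : ℂ) * g.1 1 1 - g.1 0 1 * g.1 1 0 = 1 := by
  exact_mod_cast det_entries g

/-- The point-pair invariant `|z - w|² / (Im z · Im w)`. -/
def pointPair (z w : ℍ) : ℝ := 2 * (Real.cosh (dist z w) - 1)

lemma pointPair_eq (z w : ℍ) :
    pointPair z w = ((z.re - w.re) ^ 2 + (z.im - w.im) ^ 2) / (z.im * w.im) := by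
  have hz := z.im_pos
  have hw := w.im_pos
  rw [pointPair, cosh_dist, Complex.dist_eq_re_im, Real.sq_sqrt (by positivity)]
  simp only [coe_re, coe_im]
  field_simp
  ring

lemma pointPair_smul (g : SL(2, ℝ)) (z w : ℍ) : pointPair (g • z) (g • w) = pointPair z w := by
  rw [pointPair, dist_smul, pointPair]

lemma dist_le_of_pointPair_le {z w : ℍ} (h : pointPair z w ≤ 1) : dist z w ≤ 1 := by
  by_contra hlt
  have h1 : Real.cosh 1 < Real.cosh (dist z w) := by
    rw [Real.cosh_lt_cosh, abs_one, abs_of_nonneg dist_nonneg]; exact not_le.mp hlt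
  have h2 : (3 : ℝ) / 2 ≤ Real.cosh 1 := by
    have h3 := Real.cosh_sq 1
    have h4 : (1 : ℝ) ≤ Real.sinh 1 := Real.self_le_sinh_iff.mpr zero_le_one
    have h5 := Real.exp_one_gt_d9
    have h6 := Real.cosh_add_sinh 1
    have h7 := Real.cosh_sub_sinh 1
    have h8 := Real.exp_pos (-1)
    nlinarith
  unfold pointPair at h
  linarith

/-- A smooth cutoff on `[0, ∞)`, positive on `[0, 1)` and zero on `[1, ∞)`. -/
def cutoff (t : ℝ) : ℝ := Real.smoothTransition (1 - t)

lemma contDiff_cutoff : ContDiff ℝ ∞ cutoff :=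
  Real.smoothTransition.contDiff.comp (contDiff_const.sub contDiff_id)

lemma cutoff_nonneg (t : ℝ) : 0 ≤ cutoff t := Real.smoothTransition.nonneg _

lemma cutoff_le_one (t : ℝ) : cutoff t ≤ 1 := Real.smoothTransition.le_one _

lemma cutoff_eq_zero {t : ℝ} (ht : 1 ≤ t) : cutoff t = 0 :=
  Real.smoothTransition.zero_of_nonpos (by linarith)

lemma continuous_deriv_cutoff : Continuous (deriv cutoff) :=
  contDiff_cutoff.continuous_deriv (by simp)

lemma deriv_cutoff_eq_zero {t : ℝ} (ht : 1 < t) : deriv cutoff t = 0 := by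
  have : cutoff =ᶠ[nhds t] fun _ => 0 := by
    filter_upwards [lt_mem_nhds ht] with s hs using cutoff_eq_zero hs.le
  rw [this.deriv_eq]; simp

/-- A point-pair invariant bump: a smooth function of the distance between `z` and `w`, supported
in `dist z w ≤ 1`. -/
def bump (z w : ℍ) : ℝ := cutoff (pointPair z w)

/-- The derivative `2 i Im w · ∂/∂w` of the bump, in closed form. -/
def bumpDeriv (z w : ℍ) : ℂ :=
  ((deriv cutoff (pointPair z w) : ℝ) : ℂ) *
    ((conj (w : ℂ) - conj (z : ℂ)) * (z - conj (w : ℂ)) / (z.im * w.im))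

lemma bump_smul (g : SL(2, ℝ)) (z w : ℍ) : bump (g • z) (g • w) = bump z w := by
  rw [bump, pointPair_smul, bump]

/-- In the second variable the derivative of the bump has weight `2`. -/
lemma bumpDeriv_smul (g : SL(2, ℝ)) (z w : ℍ) :
    bumpDeriv (g • z) (g • w) = autEps g w ^ 2 * bumpDeriv z w := by
  have hjz := autJ_ne_zero g z
  have hjw := autJ_ne_zero g w
  have hjz' : conj (autJ g z) ≠ 0 := (map_ne_zero _).mpr hjz
  have hjw' : conj (autJ g w) ≠ 0 := (map_ne_zero _).mpr hjw
  have hyz : (z.im : ℂ) ≠ 0 := Complex.ofReal_ne_zero.mpr z.im_ne_zero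
  have hyw : (w.im : ℂ) ≠ 0 := Complex.ofReal_ne_zero.mpr w.im_ne_zero
  have hdet := det_entries_complex g
  have e1 : conj ((g • w : ℍ) : ℂ) - conj ((g • z : ℍ) : ℂ) =
      (conj (w : ℂ) - conj (z : ℂ)) / (conj (autJ g w) * conj (autJ g z)) := by
    rw [coe_smul_eq, coe_smul_eq, map_div₀, map_div₀, div_sub_div _ _ hjw' hjz']
    congr 1
    simp only [autJ, map_add, map_mul, Complex.conj_ofReal]
    linear_combination (conj (w : ℂ) - conj (z : ℂ)) * hdet
  have e2 : ((g • z : ℍ) : ℂ) - conj ((g • w : ℍ) : ℂ) =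
      (z - conj (w : ℂ)) / (autJ g z * conj (autJ g w)) := by
    rw [coe_smul_eq, coe_smul_eq, map_div₀, div_sub_div _ _ hjz hjw']
    congr 1
    simp only [autJ, map_add, map_mul, Complex.conj_ofReal]
    linear_combination (z - conj (w : ℂ)) * hdet
  rw [bumpDeriv, bumpDeriv, pointPair_smul, e1, e2, im_smul_eq, im_smul_eq, autEps_sq]
  field_simp

lemma integral_smul_eq (g : SL(2, ℝ)) (F : ℍ → ℂ) : ∫ z, F (g • z) = ∫ z, F z :=
  integral_smul_eq_self F

/-- The derivative of the bump has mean zero in the first variable: the half turn about `w`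
changes its sign, as it has weight `2` in the second variable. -/
lemma integral_bumpDeriv (w : ℍ) : ∫ z, bumpDeriv z w = 0 := by
  -- the half turn `z ↦ -1 / z` about `i`
  set S : SL(2, ℝ) := ⟨!![0, -1; 1, 0], by simp⟩ with hS
  have hI : ∫ z, bumpDeriv z I = 0 := by
    have hSI : S • I = I := by
      ext
      rw [coe_smul_eq]
      simp [hS, autJ]
    have hsq : autEps S I ^ 2 = -1 := by
      rw [autEps_sq]; simp [hS, autJ]
    have h1 : ∫ z, bumpDeriv z I = -∫ z, bumpDeriv z I := by
      calc ∫ z, bumpDeriv z I = ∫ z, bumpDeriv (S • z) I := (integral_smul_eq S _).symm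
        _ = ∫ z, -bumpDeriv z I := by
            congr 1; ext z
            conv_lhs => rw [← hSI, bumpDeriv_smul, hsq, neg_one_mul]
        _ = _ := integral_neg _
    exact self_eq_neg.mp h1
  rw [← integral_smul_eq w.toSL2R]
  conv_lhs =>
    enter [2, z]
    rw [← toSL2R_smul_I w, toSL2R_smul_I w]
  have : ∀ z : ℍ, bumpDeriv (w.toSL2R • z) w = autEps w.toSL2R I ^ 2 * bumpDeriv z I := fun z => by
    rw [← bumpDeriv_smul, toSL2R_smul_I]
  simp_rw [this]
  rw [integral_const_mul, hI, mul_zero]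

lemma integral_bump (w : ℍ) : ∫ z, (bump z w : ℂ) = ∫ z, (bump z I : ℂ) := by
  rw [← integral_smul_eq w.toSL2R]
  congr 1; ext z
  conv_lhs => rw [← bump_smul w.toSL2R⁻¹, inv_smul_smul]
  congr 2
  rw [inv_smul_eq_iff, toSL2R_smul_I]

lemma continuous_pointPair : Continuous fun p : ℍ × ℍ => pointPair p.1 p.2 := by
  unfold pointPair; fun_prop

lemma continuous_bump : Continuous fun p : ℍ × ℍ => bump p.1 p.2 :=
  contDiff_cutoff.continuous.comp continuous_pointPair

lemma continuous_bumpDeriv : Continuous fun p : ℍ × ℍ => bumpDeriv p.1 p.2 := by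
  have h := continuous_deriv_cutoff.comp continuous_pointPair
  have h1 : Continuous fun p : ℍ × ℍ => (p.1 : ℂ) := continuous_coe.comp continuous_fst
  have h2 : Continuous fun p : ℍ × ℍ => (p.2 : ℂ) := continuous_coe.comp continuous_snd
  have h3 : Continuous fun p : ℍ × ℍ => (p.1.im : ℂ) :=
    Complex.continuous_ofReal.comp (continuous_im.comp continuous_fst)
  have h4 : Continuous fun p : ℍ × ℍ => (p.2.im : ℂ) :=
    Complex.continuous_ofReal.comp (continuous_im.comp continuous_snd)
  unfold bumpDeriv
  refine (Complex.continuous_ofReal.comp h).mul (Continuous.div ?_ (h3.mul h4) fun p => ?_)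
  · exact ((Complex.continuous_conj.comp h2).sub (Complex.continuous_conj.comp h1)).mul
      (h1.sub (Complex.continuous_conj.comp h2))
  · exact mul_ne_zero (Complex.ofReal_ne_zero.mpr p.1.im_ne_zero)
      (Complex.ofReal_ne_zero.mpr p.2.im_ne_zero)

lemma bump_eq_zero {z w : ℍ} (h : 1 < dist z w) : bump z w = 0 :=
  cutoff_eq_zero (not_le.mp (fun h' => absurd (dist_le_of_pointPair_le h') (not_le.mpr h))).le

lemma bumpDeriv_eq_zero {z w : ℍ} (h : 1 < dist z w) : bumpDeriv z w = 0 := by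
  rw [bumpDeriv, deriv_cutoff_eq_zero
    (not_le.mp (fun h' => absurd (dist_le_of_pointPair_le h') (not_le.mpr h)))]
  simp

lemma integral_bump_pos : 0 < ∫ z, bump z I := by
  have hc : Continuous fun z => bump z I :=
    Continuous.comp (g := fun p : ℍ × ℍ => bump p.1 p.2) (f := fun z : ℍ => (z, I))
      continuous_bump (by fun_prop)
  refine hc.integral_pos_of_hasCompactSupport_nonneg_nonzero ?_ (fun z => cutoff_nonneg _)
    (x := I) ?_
  · refine HasCompactSupport.intro (isCompact_closedBall I 1) fun z hz => bump_eq_zero ?_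
    simpa using hz
  · simp [bump, pointPair, cutoff]

lemma exists_norm_bumpDeriv_le : ∃ C, ∀ z w, ‖bumpDeriv z w‖ ≤ C := by
  have hc : Continuous fun z => bumpDeriv z I :=
    Continuous.comp (g := fun p : ℍ × ℍ => bumpDeriv p.1 p.2) (f := fun z : ℍ => (z, I))
      continuous_bumpDeriv (by fun_prop)
  obtain ⟨C, hC⟩ := hc.bounded_above_of_compact_support
    (HasCompactSupport.intro (isCompact_closedBall I 1) fun z hz =>
      bumpDeriv_eq_zero (by simpa using hz))
  refine ⟨C, fun z w => ?_⟩
  have h := bumpDeriv_smul w.toSL2R (w.toSL2R⁻¹ • z) I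
  rw [smul_inv_smul, toSL2R_smul_I] at h
  rw [h, norm_mul, norm_pow, norm_autEps, one_pow, one_mul]
  exact hC _

/-! ### The raising operator and Wirtinger derivatives -/

/-- The Wirtinger derivative `∂/∂z` of a function on the complex plane. -/
def wirtinger (F : ℂ → ℂ) (w : ℂ) : ℂ :=
  (fderiv ℝ F w 1 - Complex.I * fderiv ℝ F w Complex.I) / 2

lemma ddz_eq_wirtinger (ψ : ℍ → ℂ) (z : ℍ) : ddz ψ z = wirtinger (ψ ∘ ofComplex) z := rfl

lemma wirtinger_congr {F G : ℂ → ℂ} {w : ℂ} (h : F =ᶠ[nhds w] G) :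
    wirtinger F w = wirtinger G w := by
  rw [wirtinger, h.fderiv_eq, wirtinger]

lemma wirtinger_mul {F G : ℂ → ℂ} {w : ℂ} (hF : DifferentiableAt ℝ F w)
    (hG : DifferentiableAt ℝ G w) :
    wirtinger (fun x => F x * G x) w = wirtinger F w * G w + F w * wirtinger G w := by
  rw [wirtinger, fderiv_fun_mul hF hG, wirtinger, wirtinger]
  simp only [add_apply, smul_apply, smul_eq_mul]
  ring

lemma wirtinger_comp_of_hasDerivAt {F m : ℂ → ℂ} {m' w : ℂ} (hm : HasDerivAt m m' w)
    (hF : DifferentiableAt ℝ F (m w)) :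
    wirtinger (fun x => F (m x)) w = wirtinger F (m w) * m' := by
  have h := (hF.hasFDerivAt.comp w (hm.hasFDerivAt.restrictScalars ℝ)).fderiv
  have h' : fderiv ℝ (fun x => F (m x)) w = _ := h
  rw [wirtinger, h', wirtinger]
  set A := fderiv ℝ F (m w)
  have hA : ∀ v : ℂ, A v = v.re * A 1 + v.im * A Complex.I := fun v => by
    conv_lhs => rw [← Complex.re_add_im v, map_add,
      show (v.re : ℂ) = v.re • (1 : ℂ) by simp,
      show (v.im : ℂ) * Complex.I = v.im • Complex.I by simp, map_smul, map_smul]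
    simp
  simp only [ContinuousLinearMap.coe_comp, Function.comp_apply,
    ContinuousLinearMap.coe_restrictScalars', ContinuousLinearMap.toSpanSingleton_apply,
    smul_eq_mul, one_mul]
  rw [hA m', hA (Complex.I * m')]
  have hm' : m' = m'.re + m'.im * Complex.I := (Complex.re_add_im m').symm
  simp
  linear_combination ((m'.im : ℂ) * A Complex.I / 2) * Complex.I_sq -
    (A 1 - Complex.I * A Complex.I) / 2 * hm'

/-- Antiholomorphic functions are killed by `∂/∂z`. -/
lemma wirtinger_conj_of_hasDerivAt {h : ℂ → ℂ} {h' w : ℂ} (hh : HasDerivAt h h' w) :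
    DifferentiableAt ℝ (fun x => conj (h x)) w ∧ wirtinger (fun x => conj (h x)) w = 0 := by
  have h1 := Complex.conjCLE.toContinuousLinearMap.hasFDerivAt.comp w
    (hh.hasFDerivAt.restrictScalars ℝ)
  have h2 : HasFDerivAt (𝕜 := ℝ) (fun x => conj (h x)) _ w := h1
  refine ⟨h2.differentiableAt, ?_⟩
  rw [wirtinger, h2.fderiv]
  simp
  linear_combination conj h' * Complex.I_sq

lemma hasFDerivAt_im_ofReal (w : ℂ) :
    HasFDerivAt (𝕜 := ℝ) (fun x : ℂ => (x.im : ℂ))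
      (Complex.ofRealCLM.comp Complex.imCLM) w :=
  (Complex.ofRealCLM.comp Complex.imCLM).hasFDerivAt

lemma wirtinger_im (w : ℂ) : wirtinger (fun x : ℂ => (x.im : ℂ)) w = -Complex.I / 2 := by
  rw [wirtinger, (hasFDerivAt_im_ofReal w).fderiv]
  simp

lemma isOpen_upper : IsOpen {w : ℂ | 0 < w.im} := isOpen_lt continuous_const Complex.continuous_im

/-- A function on the upper half-plane divided by the imaginary part, on the complex plane. -/
def divIm (f : ℍ → ℂ) (w : ℂ) : ℂ := f (ofComplex w) / w.im

lemma contDiffOn_divIm {f : ℍ → ℂ} (hf : ContDiffOn ℝ ∞ (f ∘ ofComplex) {w : ℂ | 0 < w.im}) :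
    ContDiffOn ℝ ∞ (divIm f) {w : ℂ | 0 < w.im} := by
  have h : divIm f = fun w => (f ∘ ofComplex) w * (w.im : ℂ)⁻¹ :=
    funext fun w => div_eq_mul_inv _ _
  rw [h]
  refine hf.mul (ContDiffOn.inv ?_ fun w hw => Complex.ofReal_ne_zero.mpr (ne_of_gt hw))
  exact (Complex.ofRealCLM.comp Complex.imCLM).contDiff.contDiffOn

lemma differentiableAt_divIm {f : ℍ → ℂ}
    (hf : ContDiffOn ℝ ∞ (f ∘ ofComplex) {w : ℂ | 0 < w.im}) {w : ℂ} (hw : 0 < w.im) :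
    DifferentiableAt ℝ (divIm f) w :=
  ((contDiffOn_divIm hf).contDiffAt (isOpen_upper.mem_nhds hw)).differentiableAt (by simp)

lemma divIm_coe (f : ℍ → ℂ) (z : ℍ) : divIm f z = f z / z.im := by
  rw [divIm, ofComplex_apply]; rfl

/-- On weight `-2` the raising operator is the Wirtinger derivative of `f / y`, times `2 i y²`. -/
lemma raising_eq {f : ℍ → ℂ} (hf : ContDiffOn ℝ ∞ (f ∘ ofComplex) {w : ℂ | 0 < w.im}) (z : ℍ) :
    raising (-2) f z = 2 * Complex.I * (z.im : ℂ) ^ 2 * wirtinger (divIm f) z := by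
  have hy : (z.im : ℂ) ≠ 0 := Complex.ofReal_ne_zero.mpr z.im_ne_zero
  have h1 : (f ∘ ofComplex) =ᶠ[nhds (z : ℂ)] fun w => divIm f w * (w.im : ℂ) := by
    filter_upwards [isOpen_upper.mem_nhds z.im_pos] with w hw
    rw [divIm, div_mul_cancel₀ _ (Complex.ofReal_ne_zero.mpr (ne_of_gt hw))]; rfl
  rw [raising, ddz_eq_wirtinger, wirtinger_congr h1,
    wirtinger_mul (differentiableAt_divIm hf z.im_pos) (hasFDerivAt_im_ofReal _).differentiableAt,
    wirtinger_im, divIm_coe]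
  simp only [coe_im]
  push_cast
  field_simp
  linear_combination (-f z) * Complex.I_sq

lemma hasDerivAt_moebius (g : SL(2, ℝ)) (z : ℍ) :
    HasDerivAt (fun w : ℂ => ((g.1 0 0 : ℂ) * w + g.1 0 1) / ((g.1 1 0 : ℂ) * w + g.1 1 1))
      (1 / autJ g z ^ 2) z := by
  have h1 : HasDerivAt (fun w : ℂ => (g.1 0 0 : ℂ) * w + g.1 0 1) (g.1 0 0 : ℂ) z := by
    simpa using ((hasDerivAt_id (z : ℂ)).const_mul (g.1 0 0 : ℂ)).add_const (g.1 0 1 : ℂ)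
  have h2 : HasDerivAt (fun w : ℂ => (g.1 1 0 : ℂ) * w + g.1 1 1) (g.1 1 0 : ℂ) z := by
    simpa using ((hasDerivAt_id (z : ℂ)).const_mul (g.1 1 0 : ℂ)).add_const (g.1 1 1 : ℂ)
  have hj : (g.1 1 0 : ℂ) * z + g.1 1 1 ≠ 0 := autJ_ne_zero g z
  convert! h1.div h2 hj using 1
  rw [autJ]
  congr 1
  linear_combination -det_entries_complex g

/-- The raising operator takes forms of weight `-2` to invariant functions. -/
lemma raising_smul {Γ : Subgroup SL(2, ℝ)} {f : ℍ → ℂ} (hf : IsSmoothForm Γ (-2) f)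
    {g : SL(2, ℝ)} (hg : g ∈ Γ) (z : ℍ) : raising (-2) f (g • z) = raising (-2) f z := by
  have hj := autJ_ne_zero g z
  have hj' : conj (autJ g z) ≠ 0 := (map_ne_zero _).mpr hj
  set m : ℂ → ℂ := fun w => ((g.1 0 0 : ℂ) * w + g.1 0 1) / ((g.1 1 0 : ℂ) * w + g.1 1 1) with hm
  have hmz : ∀ w : ℍ, m w = ((g • w : ℍ) : ℂ) := fun w => (coe_smul_eq g w).symm
  have hpow : HasDerivAt (fun w : ℂ => ((g.1 1 0 : ℂ) * w + g.1 1 1) ^ 2)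
      (2 * ((g.1 1 0 : ℂ) * z + g.1 1 1) * g.1 1 0) z := by
    have h2 : HasDerivAt (fun w : ℂ => (g.1 1 0 : ℂ) * w + g.1 1 1) (g.1 1 0 : ℂ) z := by
      simpa using ((hasDerivAt_id (z : ℂ)).const_mul (g.1 1 0 : ℂ)).add_const (g.1 1 1 : ℂ)
    simpa using h2.fun_pow 2
  have hloc : (fun w => divIm f (m w)) =ᶠ[nhds (z : ℂ)]
      fun w => conj (((g.1 1 0 : ℂ) * w + g.1 1 1) ^ 2) * divIm f w := by
    filter_upwards [isOpen_upper.mem_nhds z.im_pos] with w hw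
    set w' : ℍ := ⟨w, hw⟩ with hw'
    have hjw := autJ_ne_zero g w'
    have hjw' : conj (autJ g w') ≠ 0 := (map_ne_zero _).mpr hjw
    have hyw : (w'.im : ℂ) ≠ 0 := Complex.ofReal_ne_zero.mpr w'.im_ne_zero
    change divIm f (m (w' : ℂ)) = conj (autJ g w' ^ 2) * divIm f (w' : ℂ)
    rw [hmz, divIm_coe, divIm_coe, hf.transform g hg, im_smul_eq, zpow_neg,
      show (2 : ℤ) = ((2 : ℕ) : ℤ) from rfl, zpow_natCast, autEps_sq, map_pow]
    field_simp
  have h1 := wirtinger_congr hloc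
  rw [wirtinger_comp_of_hasDerivAt (hasDerivAt_moebius g z)
    (by
      change DifferentiableAt ℝ (divIm f) (m z)
      rw [hmz]
      exact differentiableAt_divIm hf.smooth (g • z).im_pos)] at h1
  rw [wirtinger_mul (wirtinger_conj_of_hasDerivAt hpow).1
    (differentiableAt_divIm hf.smooth z.im_pos), (wirtinger_conj_of_hasDerivAt hpow).2, zero_mul,
    zero_add] at h1
  have h2 : wirtinger (divIm f) ((g • z : ℍ) : ℂ) * (1 / autJ g z ^ 2) =
      conj (autJ g z ^ 2) * wirtinger (divIm f) z := by
    rw [← hmz]; exact h1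
  rw [raising_eq hf.smooth, raising_eq hf.smooth, im_smul_eq]
  have h3 : wirtinger (divIm f) ((g • z : ℍ) : ℂ) =
      autJ g z ^ 2 * conj (autJ g z) ^ 2 * wirtinger (divIm f) z := by
    rw [map_pow] at h2
    field_simp at h2
    rw [h2]
  rw [h3]
  field_simp

lemma continuous_of_smooth {f : ℍ → ℂ} (hf : ContDiffOn ℝ ∞ (f ∘ ofComplex) {w : ℂ | 0 < w.im}) :
    Continuous f := by
  have h := hf.continuousOn.comp_continuous continuous_coe (fun z => z.im_pos)
  convert! h using 1
  ext z
  simp [ofComplex_apply]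

lemma continuous_dx_dy {f : ℍ → ℂ}
    (hf : ContDiffOn ℝ ∞ (f ∘ ofComplex) {w : ℂ | 0 < w.im}) :
    Continuous (dx f) ∧ Continuous (dy f) := by
  have h := hf.continuousOn_fderiv_of_isOpen isOpen_upper (by simp)
  have h1 : ∀ v : ℂ, Continuous fun z : ℍ => fderiv ℝ (f ∘ ofComplex) (z : ℂ) v := fun v =>
    (h.clm_apply continuousOn_const).comp_continuous continuous_coe fun z => z.im_pos
  exact ⟨h1 1, h1 Complex.I⟩

lemma continuous_raising {k : ℤ} {f : ℍ → ℂ}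
    (hf : ContDiffOn ℝ ∞ (f ∘ ofComplex) {w : ℂ | 0 < w.im}) : Continuous (raising k f) := by
  obtain ⟨hx, hy⟩ := continuous_dx_dy hf
  have hi : Continuous fun z : ℍ => (z.im : ℂ) := Complex.continuous_ofReal.comp continuous_im
  have := continuous_of_smooth hf
  unfold raising ddz
  fun_prop

lemma continuous_lowering {k : ℤ} {f : ℍ → ℂ}
    (hf : ContDiffOn ℝ ∞ (f ∘ ofComplex) {w : ℂ | 0 < w.im}) : Continuous (lowering k f) := by
  obtain ⟨hx, hy⟩ := continuous_dx_dy hf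
  have hi : Continuous fun z : ℍ => (z.im : ℂ) := Complex.continuous_ofReal.comp continuous_im
  have := continuous_of_smooth hf
  unfold lowering ddzbar
  fun_prop

/-- The hyperbolic measure in the coordinates of the plane. -/
lemma integral_eq_setIntegral (F : ℍ → ℂ) :
    ∫ z, F z = ∫ w in {w : ℂ | 0 < w.im}, ((w.im : ℂ) ^ 2)⁻¹ * F (ofComplex w) := by
  have hr : Set.range ((↑) : ℍ → ℂ) = {w : ℂ | 0 < w.im} := range_coe
  rw [← hr, ← measurableEmbedding_coe.map_comap, measurableEmbedding_coe.integral_map, volume_def,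
    integral_withDensity_eq_integral_smul]
  · congr 1
    ext z
    simp [ofComplex_apply, NNReal.smul_def, Complex.real_smul]
  · refine Continuous.measurable ?_
    refine .pow (.div₀ continuous_const ?_ ?_) _
    · exact continuous_im.subtype_mk _
    · exact fun x ↦ NNReal.ne_iff.mp x.im_ne_zero

/-! ### Integration by parts against the point-pair invariant -/

lemma integrable_mul_of_tsupport {F G : ℂ → ℂ} {U : Set ℂ} (hU : IsOpen U)
    (hF : Continuous F) (hc : HasCompactSupport F) (hs : tsupport F ⊆ U) (hG : ContinuousOn G U) :
    Integrable fun w => F w * G w := by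
  refine Continuous.integrable_of_hasCompactSupport ?_ hc.mul_right
  refine continuous_of_tsupport fun w hw => ?_
  have hw' : w ∈ U := hs (tsupport_mul_subset_left hw)
  exact hF.continuousAt.mul (hG.continuousAt (hU.mem_nhds hw'))

lemma integral_mul_wirtinger {F G : ℂ → ℂ} {U : Set ℂ} (hU : IsOpen U) (hF : ContDiff ℝ ∞ F)
    (hc : HasCompactSupport F) (hs : tsupport F ⊆ U) (hG : ContDiffOn ℝ ∞ G U) :
    ∫ w, F w * wirtinger G w = -∫ w, wirtinger F w * G w := by
  have hF1 : ∀ v : ℂ, Continuous fun w => fderiv ℝ F w v := fun v =>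
    (hF.continuous_fderiv (by simp)).clm_apply continuous_const
  have hF2 : ∀ v : ℂ, tsupport (fun w => fderiv ℝ F w v) ⊆ tsupport F := fun v =>
    tsupport_fderiv_apply_subset ℝ v
  have hF3 : ∀ v : ℂ, HasCompactSupport fun w => fderiv ℝ F w v := fun v => hc.fderiv_apply ℝ v
  have hG1 : ∀ v : ℂ, ContinuousOn (fun w => fderiv ℝ G w v) U := fun v =>
    (hG.continuousOn_fderiv_of_isOpen hU (by simp)).clm_apply continuousOn_const
  have h1 : ∀ v, Integrable fun w => F w * fderiv ℝ G w v := fun v =>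
    integrable_mul_of_tsupport hU hF.continuous hc hs (hG1 v)
  have h2 : ∀ v, Integrable fun w => fderiv ℝ F w v * G w := fun v =>
    integrable_mul_of_tsupport hU (hF1 v) (hF3 v) ((hF2 v).trans hs) hG.continuousOn
  have key : ∀ v, ∫ w, F w * fderiv ℝ G w v = -∫ w, fderiv ℝ F w v * G w := fun v =>
    integral_mul_fderiv_eq_neg_fderiv_mul_of_integrable (h2 v) (h1 v)
      (integrable_mul_of_tsupport hU hF.continuous hc hs hG.continuousOn)
      (fun w _ => (hF.differentiable (by simp)) w)
      (fun w hw => (hG.contDiffAt (hU.mem_nhds (hs hw))).differentiableAt (by simp))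
  have e1 : ∀ w, F w * wirtinger G w =
      (F w * fderiv ℝ G w 1 - Complex.I * (F w * fderiv ℝ G w Complex.I)) / 2 := fun w => by
    rw [wirtinger]; ring
  have e2 : ∀ w, wirtinger F w * G w =
      (fderiv ℝ F w 1 * G w - Complex.I * (fderiv ℝ F w Complex.I * G w)) / 2 := fun w => by
    rw [wirtinger]; ring
  simp_rw [e1, e2]
  rw [integral_div, integral_div, integral_sub (h1 1) ((h1 _).const_mul _),
    integral_sub (h2 1) ((h2 _).const_mul _), integral_const_mul, integral_const_mul, key, key]
  ring

lemma wirtinger_ofReal_comp {h : ℝ → ℝ} {u : ℂ → ℝ} {w : ℂ} (hh : DifferentiableAt ℝ h (u w))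
    (hu : DifferentiableAt ℝ u w) :
    wirtinger (fun x => ((h (u x) : ℝ) : ℂ)) w =
      ((deriv h (u w) : ℝ) : ℂ) * wirtinger (fun x => (u x : ℂ)) w := by
  have h1 : HasFDerivAt (𝕜 := ℝ) (fun x => (u x : ℂ)) _ w :=
    Complex.ofRealCLM.hasFDerivAt.comp w hu.hasFDerivAt
  have h2 : HasFDerivAt (𝕜 := ℝ) (fun x => ((h (u x) : ℝ) : ℂ)) _ w :=
    Complex.ofRealCLM.hasFDerivAt.comp w (hh.hasDerivAt.comp_hasFDerivAt w hu.hasFDerivAt)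
  rw [wirtinger, wirtinger, h1.fderiv, h2.fderiv]
  simp
  ring

/-- The point-pair invariant with the second variable in the complex plane. -/
def planePair (z : ℍ) (w : ℂ) : ℝ :=
  ((z.re - w.re) ^ 2 + (z.im - w.im) ^ 2) / (z.im * w.im)

lemma planePair_coe (z w : ℍ) : planePair z w = pointPair z w := (pointPair_eq z w).symm

lemma contDiffAt_planePair (z : ℍ) {w : ℂ} (hw : 0 < w.im) : ContDiffAt ℝ ∞ (planePair z) w := by
  have h1 : ContDiff ℝ ∞ fun w : ℂ => w.re := Complex.reCLM.contDiff
  have h2 : ContDiff ℝ ∞ fun w : ℂ => w.im := Complex.imCLM.contDiff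
  unfold planePair
  refine ContDiffAt.div ?_ ?_ (mul_pos z.im_pos hw).ne'
  · exact (((contDiff_const.sub h1).pow 2).add ((contDiff_const.sub h2).pow 2)).contDiffAt
  · exact (contDiff_const.mul h2).contDiffAt

/-- Derived from the product rule applied to `|z - w|² = planePair z w * (Im z * Im w)`. -/
lemma wirtinger_planePair (z w : ℍ) :
    2 * Complex.I * w.im * wirtinger (fun x => (planePair z x : ℂ)) w =
      (conj (w : ℂ) - conj (z : ℂ)) * (z - conj (w : ℂ)) / (z.im * w.im) := by
  have hzi : (z.im : ℂ) ≠ 0 := Complex.ofReal_ne_zero.mpr z.im_ne_zero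
  have hwi : (w.im : ℂ) ≠ 0 := Complex.ofReal_ne_zero.mpr w.im_ne_zero
  have hnum : ∀ x : ℂ, (((z.re - x.re) ^ 2 + (z.im - x.im) ^ 2 : ℝ) : ℂ) =
      (z - x) * conj (z - x) := fun x => by
    rw [Complex.mul_conj, Complex.normSq_apply]; simp [sq]
  have hd : DifferentiableAt ℝ (fun x => (planePair z x : ℂ)) w :=
    Complex.ofRealCLM.differentiableAt.comp _
      ((contDiffAt_planePair z w.im_pos).differentiableAt (by simp))
  have hhol : HasDerivAt (fun x : ℂ => (z : ℂ) - x) (-1) w := by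
    simpa using (hasDerivAt_id (w : ℂ)).const_sub (z : ℂ)
  have h0 : wirtinger (fun x : ℂ => (z : ℂ) - x) w = -1 := by
    rw [wirtinger, (hhol.hasFDerivAt.restrictScalars ℝ).fderiv]
    simp
    norm_num
  have hloc : (fun x : ℂ => ((z : ℂ) - x) * conj ((z : ℂ) - x)) =ᶠ[nhds (w : ℂ)]
      fun x => (planePair z x : ℂ) * ((z.im : ℂ) * (x.im : ℂ)) := by
    filter_upwards [isOpen_upper.mem_nhds w.im_pos] with x hx
    have hx' : (x.im : ℂ) ≠ 0 := Complex.ofReal_ne_zero.mpr (ne_of_gt hx)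
    rw [← hnum, planePair, Complex.ofReal_div]
    push_cast
    field_simp
  have hd' : DifferentiableAt ℝ (fun x : ℂ => (z.im : ℂ) * (x.im : ℂ)) w :=
    (differentiableAt_const _).fun_mul (hasFDerivAt_im_ofReal _).differentiableAt
  have hi : wirtinger (fun x : ℂ => (z.im : ℂ) * (x.im : ℂ)) w = z.im * (-Complex.I / 2) := by
    rw [wirtinger_mul (differentiableAt_const _) (hasFDerivAt_im_ofReal _).differentiableAt,
      wirtinger_im]
    simp [wirtinger]
  have h1 := wirtinger_congr hloc
  rw [wirtinger_mul (hhol.hasFDerivAt.restrictScalars ℝ).differentiableAt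
      (wirtinger_conj_of_hasDerivAt hhol).1, (wirtinger_conj_of_hasDerivAt hhol).2, h0,
    wirtinger_mul hd hd', hi] at h1
  have hp : (planePair z w : ℂ) = (z - w) * conj ((z : ℂ) - w) / (z.im * w.im) := by
    rw [← hnum, planePair, Complex.ofReal_div]
    push_cast; rfl
  have hw2 : (2 : ℂ) * Complex.I * w.im = w - conj (w : ℂ) := by
    rw [Complex.sub_conj]; push_cast; simp; ring
  rw [hp] at h1
  simp only [map_sub, coe_im] at h1
  have h2 : wirtinger (fun x => (planePair z x : ℂ)) w =
      ((conj (w : ℂ) - conj (z : ℂ)) +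
        (z - w) * (conj (z : ℂ) - conj (w : ℂ)) / w.im * (Complex.I / 2)) / (z.im * w.im) := by
    field_simp at h1 ⊢
    linear_combination -h1
  rw [h2]
  field_simp
  linear_combination (conj (w : ℂ) - conj (z : ℂ)) * hw2 +
    (z - w) * (conj (z : ℂ) - conj (w : ℂ)) * Complex.I_sq

/-- The bump, extended by zero to the complex plane. -/
def planeBump (z : ℍ) : ℂ → ℂ :=
  Set.indicator {w : ℂ | 0 < w.im} fun w => ((cutoff (planePair z w) : ℝ) : ℂ)

lemma planeBump_coe (z w : ℍ) : planeBump z w = bump z w := by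
  rw [planeBump, Set.indicator_of_mem (show (w : ℂ) ∈ {w : ℂ | 0 < w.im} from w.im_pos),
    planePair_coe, bump]

lemma isCompact_coe_closedBall (z : ℍ) :
    IsCompact ((↑) '' Metric.closedBall z 1 : Set ℂ) :=
  (isCompact_closedBall z 1).image continuous_coe

lemma support_planeBump (z : ℍ) :
    Function.support (planeBump z) ⊆ ((↑) '' Metric.closedBall z 1 : Set ℂ) := by
  intro w hw
  by_cases h : 0 < w.im
  · refine ⟨⟨w, h⟩, ?_, rfl⟩
    rw [Metric.mem_closedBall, dist_comm]
    by_contra hlt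
    refine hw ?_
    have := planeBump_coe z ⟨w, h⟩
    rw [bump_eq_zero (not_le.mp hlt)] at this
    simpa using this
  · exact absurd (Set.indicator_of_notMem (s := {w : ℂ | 0 < w.im}) h _) hw

lemma tsupport_planeBump (z : ℍ) : tsupport (planeBump z) ⊆ {w : ℂ | 0 < w.im} := by
  refine (closure_minimal (support_planeBump z) (isCompact_coe_closedBall z).isClosed).trans ?_
  rintro _ ⟨w, -, rfl⟩
  exact w.im_pos

lemma hasCompactSupport_planeBump (z : ℍ) : HasCompactSupport (planeBump z) :=
  HasCompactSupport.of_support_subset_isCompact (isCompact_coe_closedBall z) (support_planeBump z)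

lemma planeBump_eventuallyEq (z : ℍ) {w : ℂ} (hw : 0 < w.im) :
    planeBump z =ᶠ[nhds w] fun w => ((cutoff (planePair z w) : ℝ) : ℂ) := by
  filter_upwards [isOpen_upper.mem_nhds hw] with x hx
  exact Set.indicator_of_mem (s := {w : ℂ | 0 < w.im}) hx _

lemma contDiff_planeBump (z : ℍ) : ContDiff ℝ ∞ (planeBump z) := by
  rw [contDiff_iff_contDiffAt]
  intro w
  by_cases hw : w ∈ tsupport (planeBump z)
  · have hw' := tsupport_planeBump z hw
    refine ContDiffAt.congr_of_eventuallyEq ?_ (planeBump_eventuallyEq z hw')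
    exact Complex.ofRealCLM.contDiff.contDiffAt.comp w
      (contDiff_cutoff.contDiffAt.comp w (contDiffAt_planePair z hw'))
  · refine ContDiffAt.congr_of_eventuallyEq contDiffAt_const
      (notMem_tsupport_iff_eventuallyEq.mp hw)

lemma wirtinger_planeBump (z w : ℍ) :
    2 * Complex.I * w.im * wirtinger (planeBump z) w = bumpDeriv z w := by
  rw [wirtinger_congr (planeBump_eventuallyEq z w.im_pos),
    wirtinger_ofReal_comp ((contDiff_cutoff.differentiable (by simp)) _)
      ((contDiffAt_planePair z w.im_pos).differentiableAt (by simp)), bumpDeriv,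
    ← wirtinger_planePair, planePair_coe]
  ring

/-- Integration by parts against the bump. The factor `y⁻²` of the hyperbolic measure turns `R f`
into the Wirtinger derivative of `f / y`. -/
lemma integral_bump_mul_raising {f : ℍ → ℂ}
    (hf : ContDiffOn ℝ ∞ (f ∘ ofComplex) {w : ℂ | 0 < w.im}) (z : ℍ) :
    ∫ w, (bump z w : ℂ) * raising (-2) f w = -∫ w, bumpDeriv z w * f w := by
  have hmeas : MeasurableSet {w : ℂ | 0 < w.im} := isOpen_upper.measurableSet
  have hw0 : ∀ w : ℂ, w ∉ {w : ℂ | 0 < w.im} → wirtinger (planeBump z) w = 0 := fun w hw => by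
    have := fun h => hw (tsupport_planeBump z h)
    rw [wirtinger_congr (notMem_tsupport_iff_eventuallyEq.mp this), wirtinger]
    simp
  have e1 : ∫ w in {w : ℂ | 0 < w.im}, planeBump z w * wirtinger (divIm f) w =
      ∫ w, planeBump z w * wirtinger (divIm f) w := by
    refine setIntegral_eq_integral_of_forall_compl_eq_zero fun w hw => ?_
    rw [show planeBump z w = 0 from Set.indicator_of_notMem hw _, zero_mul]
  have e2 : ∫ w in {w : ℂ | 0 < w.im}, wirtinger (planeBump z) w * divIm f w =
      ∫ w, wirtinger (planeBump z) w * divIm f w := by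
    refine setIntegral_eq_integral_of_forall_compl_eq_zero fun w hw => ?_
    rw [hw0 w hw, zero_mul]
  have h1 : ∫ w, (bump z w : ℂ) * raising (-2) f w =
      2 * Complex.I * ∫ w, planeBump z w * wirtinger (divIm f) w := by
    rw [integral_eq_setIntegral, ← e1, ← integral_const_mul]
    refine setIntegral_congr_fun hmeas fun w hw => ?_
    have hy : ((w.im : ℝ) : ℂ) ≠ 0 := Complex.ofReal_ne_zero.mpr (ne_of_gt hw)
    obtain ⟨w, rfl⟩ : ∃ w' : ℍ, (w' : ℂ) = w := ⟨⟨w, hw⟩, rfl⟩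
    simp only [ofComplex_apply, planeBump_coe, raising_eq hf]
    simp only [coe_im] at hy ⊢
    field_simp
  have h2 : ∫ w, bumpDeriv z w * f w =
      2 * Complex.I * ∫ w, wirtinger (planeBump z) w * divIm f w := by
    rw [integral_eq_setIntegral, ← e2, ← integral_const_mul]
    refine setIntegral_congr_fun hmeas fun w hw => ?_
    have hy : ((w.im : ℝ) : ℂ) ≠ 0 := Complex.ofReal_ne_zero.mpr (ne_of_gt hw)
    obtain ⟨w, rfl⟩ : ∃ w' : ℍ, (w' : ℂ) = w := ⟨⟨w, hw⟩, rfl⟩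
    simp only [ofComplex_apply, ← wirtinger_planeBump, divIm_coe]
    simp only [coe_im] at hy ⊢
    field_simp
  rw [h1, h2, integral_mul_wirtinger isOpen_upper (contDiff_planeBump z)
    (hasCompactSupport_planeBump z) (tsupport_planeBump z) (contDiffOn_divIm hf)]
  ring

/-! ### Unfolding and the vanishing of the integral of an exact form -/

instance (Γ : Subgroup SL(2, ℝ)) : MeasurableConstSMul (transfGroup Γ) (ℍ × ℍ) where
  measurable_const_smul g :=
    ((measurable_const_smul g).comp measurable_fst).prodMk
      ((measurable_const_smul g).comp measurable_snd)

instance (Γ : Subgroup SL(2, ℝ)) :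
    SMulInvariantMeasure (transfGroup Γ) (ℍ × ℍ) ((volume : Measure ℍ).prod volume) where
  measure_preimage_smul g _ hs :=
    ((measurePreserving_smul g (volume : Measure ℍ)).prod
      (measurePreserving_smul g (volume : Measure ℍ))).measure_preimage hs.nullMeasurableSet

/-- Unfolding in either variable: a kernel invariant under the diagonal action can be integrated
over a fundamental domain of the first or of the second variable. -/
lemma integral_integral_swap_of_invariant {Γ : Subgroup SL(2, ℝ)} [DiscreteTopology Γ]
    {D : Set ℍ} (hD : IsFundDomain Γ D) {E : ℍ × ℍ → ℂ}
    (hE : ∀ γ ∈ Γ, ∀ z w : ℍ, E (γ • z, γ • w) = E (z, w))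
    (hint : Integrable E ((volume.restrict D).prod volume)) :
    ∫ z in D, ∫ w, E (z, w) = ∫ w in D, ∫ z, E (z, w) := by
  have h1 : IsFundamentalDomain (transfGroup Γ) (Prod.fst ⁻¹' D)
      ((volume : Measure ℍ).prod (volume : Measure ℍ)) :=
    IsFundamentalDomain.preimage_of_equiv hD Measure.quasiMeasurePreserving_fst
      (e := id) Function.bijective_id fun _ _ => rfl
  have h2 : IsFundamentalDomain (transfGroup Γ) (Prod.snd ⁻¹' D)
      ((volume : Measure ℍ).prod (volume : Measure ℍ)) :=
    IsFundamentalDomain.preimage_of_equiv hD Measure.quasiMeasurePreserving_snd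
      (e := id) Function.bijective_id fun _ _ => rfl
  have hinv : ∀ (g : transfGroup Γ) (p : ℍ × ℍ), E (g • p) = E p := fun g p => by
    obtain ⟨γ, hγ, h⟩ := exists_smul_eq Γ g
    rw [← hE γ hγ p.1 p.2, ← h, ← h]; rfl
  have r1 : ((volume : Measure ℍ).prod (volume : Measure ℍ)).restrict (Prod.fst ⁻¹' D) =
      (volume.restrict D).prod volume := by
    rw [← Set.prod_univ, ← Measure.prod_restrict, Measure.restrict_univ]
  have r2 : ((volume : Measure ℍ).prod (volume : Measure ℍ)).restrict (Prod.snd ⁻¹' D) =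
      (volume : Measure ℍ).prod (volume.restrict D) := by
    rw [← Set.univ_prod, ← Measure.prod_restrict, Measure.restrict_univ]
  have hint2 : Integrable E ((volume : Measure ℍ).prod (volume.restrict D)) := by
    rw [← r2]
    refine (h1.integrableOn_iff h2 hinv).mp ?_
    rw [IntegrableOn, r1]; exact hint
  rw [← integral_prod _ hint, ← integral_prod_symm _ hint2, ← r1, ← r2]
  exact h1.setIntegral_eq h2 hinv

lemma volume_closedBall_eq (z : ℍ) (r : ℝ) :
    volume (Metric.closedBall z r) = volume (Metric.closedBall I r) := by
  have h := measure_smul (volume : Measure ℍ) z.toSL2R (Metric.closedBall I r)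
  rw [Metric.smul_closedBall, toSL2R_smul_I] at h
  exact h

/-- A bounded continuous kernel supported near the diagonal is integrable over `D × ℍ` if `D` has
finite volume. -/
lemma integrable_of_support_near_diagonal {D : Set ℍ} (hvol : volume D < ⊤) {E : ℍ × ℍ → ℂ}
    (hc : Continuous E) {C : ℝ} (hC : ∀ p, ‖E p‖ ≤ C)
    (hs : ∀ p : ℍ × ℍ, 1 < dist p.1 p.2 → E p = 0) :
    Integrable E ((volume.restrict D).prod volume) := by
  set T : Set (ℍ × ℍ) := {p | dist p.1 p.2 ≤ 1} with hT
  have hTm : MeasurableSet T :=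
    (isClosed_le (continuous_fst.dist continuous_snd) continuous_const).measurableSet
  have hTv : ((volume.restrict D).prod (volume : Measure ℍ)) T < ⊤ := by
    rw [Measure.prod_apply hTm]
    have : ∀ z : ℍ, volume (Prod.mk z ⁻¹' T) = volume (Metric.closedBall I 1) := fun z => by
      rw [← volume_closedBall_eq z 1]
      congr 1; ext w
      simp [hT, dist_comm]
    simp_rw [this]
    rw [lintegral_const, Measure.restrict_apply_univ]
    exact ENNReal.mul_lt_top (isCompact_closedBall I 1).measure_lt_top hvol
  refine (integrableOn_iff_integrable_of_support_subset (s := T) fun p hp => ?_).mp ?_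
  · exact not_lt.mp fun h => hp (hs p h)
  · exact Measure.integrableOn_of_bounded hTv.ne hc.aestronglyMeasurable (M := C)
      (Filter.Eventually.of_forall hC)

/-- The integral of an exact form `R f`, for `f` bounded of weight `-2` with `R f` bounded, over a
quotient of finite volume is zero. Averaging `R f` against the bump does not change its integral;
after integrating by parts and unfolding in the other variable, `f` is multiplied by the mean of the
derivative of the bump, which is zero. -/
lemma setIntegral_raising_eq_zero {Γ : Subgroup SL(2, ℝ)} [DiscreteTopology Γ] {D : Set ℍ}
    (hD : IsFundDomain Γ D) (hvol : volume D < ⊤) {f : ℍ → ℂ} (hf : IsSmoothForm Γ (-2) f)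
    {C C' : ℝ} (hC : ∀ z, ‖f z‖ ≤ C) (hC' : ∀ z, ‖raising (-2) f z‖ ≤ C') :
    ∫ z in D, raising (-2) f z = 0 := by
  have hfc := continuous_of_smooth hf.smooth
  have hRc := continuous_raising (k := -2) hf.smooth
  obtain ⟨K, hK⟩ := exists_norm_bumpDeriv_le
  have hK0 : 0 ≤ K := (norm_nonneg _).trans (hK I I)
  set E₁ : ℍ × ℍ → ℂ := fun p => (bump p.1 p.2 : ℂ) * raising (-2) f p.2 with hE₁
  set E₂ : ℍ × ℍ → ℂ := fun p => bumpDeriv p.1 p.2 * f p.2 with hE₂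
  have hi₁ : Integrable E₁ ((volume.restrict D).prod volume) := by
    refine integrable_of_support_near_diagonal hvol
      ((Complex.continuous_ofReal.comp continuous_bump).mul (hRc.comp continuous_snd))
      (C := 1 * C') (fun p => ?_) fun p hp => by simp [hE₁, bump_eq_zero hp]
    rw [hE₁, norm_mul]
    refine mul_le_mul ?_ (hC' _) (norm_nonneg _) zero_le_one
    rw [Complex.norm_real, Real.norm_eq_abs, bump, abs_of_nonneg (cutoff_nonneg _)]
    exact cutoff_le_one _
  have hi₂ : Integrable E₂ ((volume.restrict D).prod volume) := by
    refine integrable_of_support_near_diagonal hvol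
      (continuous_bumpDeriv.mul (hfc.comp continuous_snd))
      (C := K * C) (fun p => ?_) fun p hp => by simp [hE₂, bumpDeriv_eq_zero hp]
    rw [hE₂, norm_mul]
    exact mul_le_mul (hK _ _) (hC _) (norm_nonneg _) hK0
  have hs₁ := integral_integral_swap_of_invariant hD (E := E₁) (fun γ hγ z w => by
    simp only [hE₁]; rw [bump_smul, raising_smul hf hγ]) hi₁
  have hs₂ := integral_integral_swap_of_invariant hD (E := E₂) (fun γ hγ z w => by
    have h0 : autEps γ w ≠ 0 := fun h => by simpa [h] using norm_autEps γ w
    simp only [hE₂]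
    rw [bumpDeriv_smul, hf.transform γ hγ, zpow_neg, show (2 : ℤ) = ((2 : ℕ) : ℤ) from rfl,
      zpow_natCast]
    field_simp) hi₂
  simp only [hE₁, hE₂] at hs₁ hs₂
  simp_rw [integral_mul_const] at hs₁ hs₂
  simp_rw [integral_bump, integral_bump_mul_raising hf.smooth] at hs₁
  simp_rw [integral_bumpDeriv, zero_mul] at hs₂
  rw [integral_neg, hs₂, integral_zero, neg_zero, integral_const_mul,
    integral_complex_ofReal] at hs₁
  exact (mul_eq_zero.mp hs₁.symm).resolve_left
    (Complex.ofReal_ne_zero.mpr integral_bump_pos.ne')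

lemma isSmoothForm_pairing {Γ : Subgroup SL(2, ℝ)} {k : ℤ} {φ₁ φ₂ : ℍ → ℂ}
    (h₁ : IsSmoothForm Γ k φ₁) (h₂ : IsSmoothForm Γ (k + 2) φ₂) :
    IsSmoothForm Γ (-2) (pairing φ₁ φ₂) where
  smooth := h₁.smooth.mul (Complex.conjCLE.contDiff.comp_contDiffOn h₂.smooth)
  transform γ hγ z := by
    have h0 : autEps γ z ≠ 0 := fun h => by simpa [h] using norm_autEps γ z
    have hc : conj (autEps γ z) = (autEps γ z)⁻¹ := by
      rw [Complex.inv_def, Complex.normSq_eq_norm_sq, norm_autEps]; simp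
    rw [pairing, pairing, h₁.transform γ hγ, h₂.transform γ hγ, map_mul, map_zpow₀, hc, inv_zpow',
      neg_add, zpow_add₀ h0, zpow_neg _ k]
    field_simp

lemma differentiableAt_of_smooth {f : ℍ → ℂ}
    (hf : ContDiffOn ℝ ∞ (f ∘ ofComplex) {w : ℂ | 0 < w.im}) (z : ℍ) :
    DifferentiableAt ℝ (f ∘ ofComplex) z :=
  (hf.contDiffAt (isOpen_upper.mem_nhds z.im_pos)).differentiableAt (by simp)

/-- The product rule: the sum of the two integrands is exact. -/
lemma pairing_raising_add_pairing_lowering {k : ℤ} {φ₁ φ₂ : ℍ → ℂ}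
    (h₁ : ContDiffOn ℝ ∞ (φ₁ ∘ ofComplex) {w : ℂ | 0 < w.im})
    (h₂ : ContDiffOn ℝ ∞ (φ₂ ∘ ofComplex) {w : ℂ | 0 < w.im}) (z : ℍ) :
    pairing (raising k φ₁) φ₂ z + pairing φ₁ (lowering (k + 2) φ₂) z =
      raising (-2) (pairing φ₁ φ₂) z := by
  have d₁ := differentiableAt_of_smooth h₁ z
  have d₂ := differentiableAt_of_smooth h₂ z
  have hc : HasFDerivAt (𝕜 := ℝ) (fun x => conj ((φ₂ ∘ ofComplex) x)) _ (z : ℂ) :=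
    Complex.conjCLE.toContinuousLinearMap.hasFDerivAt.comp (z : ℂ) d₂.hasFDerivAt
  have hcw : wirtinger (fun x => conj ((φ₂ ∘ ofComplex) x)) z = conj (ddzbar φ₂ z) := by
    rw [wirtinger, hc.fderiv, ddzbar, dx, dy, map_div₀, map_ofNat]
    simp
    ring
  have hp : ddz (pairing φ₁ φ₂) z = ddz φ₁ z * conj (φ₂ z) + φ₁ z * conj (ddzbar φ₂ z) := by
    have : pairing φ₁ φ₂ ∘ ofComplex =
        fun x => (φ₁ ∘ ofComplex) x * conj ((φ₂ ∘ ofComplex) x) := rfl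
    rw [ddz_eq_wirtinger, this, wirtinger_mul d₁ hc.differentiableAt, hcw, ← ddz_eq_wirtinger]
    simp [ofComplex_apply]
  rw [raising, hp, pairing, pairing, pairing, raising, lowering]
  simp only [map_sub, map_mul, map_neg, map_div₀, Complex.conj_I, Complex.conj_ofReal, map_ofNat,
    map_intCast]
  push_cast
  ring

/-- If the height is bounded below, then a pairing of negative total growth is bounded. -/
lemma CuspSystem.exists_norm_pairing_le {Γ : Subgroup SL(2, ℝ)} {ι : Type*} (S : CuspSystem Γ ι)
    {c : ℝ} (hc : 0 < c) (hS : ∀ z, c ≤ S.height z) {A B : ℝ} (hAB : A + B < 0) {ψ₁ ψ₂ : ℍ → ℂ}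
    (h₁ : S.HasGrowth ψ₁ A) (h₂ : S.HasGrowth ψ₂ B) : ∃ C, ∀ z, ‖pairing ψ₁ ψ₂ z‖ ≤ C := by
  obtain ⟨C₁, hC₁⟩ := h₁
  obtain ⟨C₂, hC₂⟩ := h₂
  refine ⟨|C₁ * C₂| * c ^ (A + B), fun z => ?_⟩
  have hz : 0 < S.height z := hc.trans_le (hS z)
  calc ‖pairing ψ₁ ψ₂ z‖ = ‖ψ₁ z‖ * ‖ψ₂ z‖ := by
        rw [pairing, norm_mul, RCLike.norm_conj]
    _ ≤ (C₁ * S.height z ^ A) * (C₂ * S.height z ^ B) :=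
        mul_le_mul (hC₁ z) (hC₂ z) (norm_nonneg _) ((norm_nonneg _).trans (hC₁ z))
    _ = C₁ * C₂ * S.height z ^ (A + B) := by rw [Real.rpow_add hz]; ring
    _ ≤ |C₁ * C₂| * c ^ (A + B) :=
        mul_le_mul (le_abs_self _) (Real.rpow_le_rpow_of_nonpos hc (hS z) hAB.le)
          (Real.rpow_nonneg hz.le _) (abs_nonneg _)

end MaassForms

end

theorem proposition9p3 (Γ : Subgroup SL(2, ℝ)) [DiscreteTopology Γ]
    (D : Set ℍ) (hD : MaassForms.IsFundDomain Γ D)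
    (hvol : MeasureTheory.volume D < ⊤)
    (hnoncompact : NoncompactSpace (MulAction.orbitRel.Quotient Γ ℍ))
    {ι : Type*} (S : MaassForms.CuspSystem Γ ι)
    (k : ℤ) (φ₁ φ₂ : ℍ → ℂ)
    (hφ₁ : MaassForms.IsSmoothForm Γ k φ₁)
    (hφ₂ : MaassForms.IsSmoothForm Γ (k + 2) φ₂)
    (A B : ℝ) (hAB : A + B < 0)
    (hgrowth₁ : S.HasGrowth φ₁ A)
    (hgrowthR : S.HasGrowth (MaassForms.raising k φ₁) A)
    (hgrowth₂ : S.HasGrowth φ₂ B)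
    (hgrowthL : S.HasGrowth (MaassForms.lowering (k + 2) φ₂) B) :
    MeasureTheory.IntegrableOn
        (MaassForms.pairing (MaassForms.raising k φ₁) φ₂) D MeasureTheory.volume ∧
      MeasureTheory.IntegrableOn
        (MaassForms.pairing φ₁ (MaassForms.lowering (k + 2) φ₂)) D MeasureTheory.volume ∧
      MaassForms.petersson D (MaassForms.raising k φ₁) φ₂
        + MaassForms.petersson D φ₁ (MaassForms.lowering (k + 2) φ₂) = 0 := by
  obtain ⟨c, hc, hS⟩ := S.exists_le_height hD hvol hnoncompact
  obtain ⟨C, hC⟩ := S.exists_norm_pairing_le hc hS hAB hgrowth₁ hgrowth₂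
  obtain ⟨C₁, hC₁⟩ := S.exists_norm_pairing_le hc hS hAB hgrowthR hgrowth₂
  obtain ⟨C₂, hC₂⟩ := S.exists_norm_pairing_le hc hS hAB hgrowth₁ hgrowthL
  have hcont : ∀ {ψ₁ ψ₂ : ℍ → ℂ}, Continuous ψ₁ → Continuous ψ₂ →
      Continuous (MaassForms.pairing ψ₁ ψ₂) := fun h₁ h₂ =>
    h₁.mul (Complex.continuous_conj.comp h₂)
  have i₁ : MeasureTheory.IntegrableOn (MaassForms.pairing (MaassForms.raising k φ₁) φ₂) D :=
    MeasureTheory.Measure.integrableOn_of_bounded hvol.ne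
      (hcont (MaassForms.continuous_raising hφ₁.smooth)
        (MaassForms.continuous_of_smooth hφ₂.smooth)).aestronglyMeasurable
      (Filter.Eventually.of_forall hC₁)
  have i₂ : MeasureTheory.IntegrableOn (MaassForms.pairing φ₁ (MaassForms.lowering (k + 2) φ₂)) D :=
    MeasureTheory.Measure.integrableOn_of_bounded hvol.ne
      (hcont (MaassForms.continuous_of_smooth hφ₁.smooth)
        (MaassForms.continuous_lowering hφ₂.smooth)).aestronglyMeasurable
      (Filter.Eventually.of_forall hC₂)
  refine ⟨i₁, i₂, ?_⟩
  have hsum := MaassForms.pairing_raising_add_pairing_lowering (k := k) hφ₁.smooth hφ₂.smooth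
  rw [MaassForms.petersson, MaassForms.petersson, ← MeasureTheory.integral_add i₁ i₂]
  simp_rw [hsum]
  refine MaassForms.setIntegral_raising_eq_zero hD hvol
    (MaassForms.isSmoothForm_pairing hφ₁ hφ₂) hC (C' := C₁ + C₂) fun z => ?_
  rw [← hsum]
  exact (norm_add_le _ _).trans (add_le_add (hC₁ z) (hC₂ z))
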